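/- **Setting.** Let $\rho\ge 1$ and $r\ge\rho$ be integers and $a\in[0,\rho)$. Let $\phi:\mathbb R\to\mathbb C$ be a compactly supported function of class $C^{\rho-1}$. For $0\le i,j\le\rho-1$ put $$\Psi^{ij}(t)=\sum_{k\in\mathbb Z}\phi^{(i)}(a+\rho k-j)\,e^{2\pi \mathrm i kt},\qquad \Psi(t)=\big(\Psi^{ij}(t)\big)_{0\le i,j\le\rho-1},$$ and assume that $\det\Psi(t)\ne 0$ for all $t\in[0,1]$. Define $$\Theta_i(t)=\sum_{v\in\mathbb Z}\sum_{j=0}^{\rho-1}\Big(\int_0^1 e^{-2\pi \mathrm i v s}\,(\Psi(s)^{-1})^{ji}\,ds\Big)\,\phi(t-\rho v-j),\qquad 0\le i\le\rho-1,$$ and, for $W\ge1$, the derivative sampling operator $$(S_Wf)(t)=\sum_{l\in\mathbb Z}\sum_{i=0}^{\rho-1}\frac1{W^i}\,f^{(i)}\Big(\frac{a+\rho l}{W}\Big)\,\Theta_i(Wt-\rho l).$$ *Averaged moduli of smoothness.* For $g:\mathbb R\to\mathbb C$, $x\in\mathbb R$, $\delta\ge0$, let $$\omega_r(g;x;\delta)=\sup\Big\{\Big|\sum_{j=0}^r(-1)^{r-j}\tbinom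 rj g(t+jh)\Big| : t,\ t+rh\in\big[x-\tfrac{r\delta}2,\,x+\tfrac{r\delta}2\big]\Big\},\qquad \tau_r(g,\delta)_p=\|\omega_r(g;\cdot\,;\delta)\|_{L^p(\mathbb R)}\in[0,\infty].$$ *The space $\Lambda^p_\rho$* ($1\le p<\infty$). A real sequence $(x_j)_{j\in\mathbb Z}$ is admissible if $0<\inf_j(x_j-x_{j-1})\le\sup_j(x_j-x_{j-1})<\infty$. $\Lambda_\rho^p$ is the set of all bounded Lebesgue measurable $f:\mathbb R\to\mathbb C$ whose derivatives $f^{(i)}$, $0\le i\le\rho-1$, exist at every point and satisfy $$\sum_{j\in\mathbb Z}\sum_{i=0}^{\rho-1}|f^{(i)}(x_j)|^p\,(x_j-x_{j-1})<\infty$$ for every admissible sequence $(x_j)$. (For $\rho=1$ no differentiability or continuity is required.) **Theorem.** Assume that, for all $W\ge1$, $S_W$ reproduces polynomials of degree at most $r$, that is, $S_WP=P$ pointwise on $\mathbb R$ for every polynomial $P$ with $\deg P\le r$. Then there are finite constants $c_0,\dots,c_{\rho-1}\ge0$, depending only on $\phi,a,\rho$ and $r$ (not on $p$, $f$ or $W$),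 such that for all $1\le p<\infty$, all $f\in\Lambda_\rho^p$ and all $W\ge1$ the series $\sum_l$ defining $(S_Wf)(t)$ converges absolutely for every $t\in\mathbb R$, and $$\|S_Wf-f\|_{L^p(\mathbb R)}\le\sum_{i=0}^{\rho-1}c_i\,\tau_r\big(f^{(i)},W^{-1}\big)_p .$$ -/

import Mathlib

open MeasureTheory Set
open scoped ENNReal NNReal Polynomial

noncomputable section

namespace DerivativeSampling

/-- The matrix-valued symbol: the entry in row `i` and column `j` of `Ψ(t)` is
`∑_{k ∈ ℤ} φ^{(i)}(a + ρ k - j) e^{2 π i k t}`. -/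
def symbolMatrix (φ : ℝ → ℂ) (a : ℝ) (ρ : ℕ) (t : ℝ) : Matrix (Fin ρ) (Fin ρ) ℂ :=
  Matrix.of fun i j =>
    ∑' k : ℤ, iteratedDeriv (i : ℕ) φ (a + (ρ : ℝ) * (k : ℝ) - ((j : ℕ) : ℝ)) *
      Complex.exp (2 * (Real.pi : ℂ) * Complex.I * (k : ℂ) * (t : ℂ))

/-- The `v`-th Fourier coefficient of the `(j, i)` entry of `Ψ⁻¹`. -/
def inverseSymbolCoeff (φ : ℝ → ℂ) (a : ℝ) (ρ : ℕ) (j i : Fin ρ) (v : ℤ) : ℂ :=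
  ∫ t in (0 : ℝ)..1,
    Complex.exp (-(2 * (Real.pi : ℂ) * Complex.I * (v : ℂ) * (t : ℂ))) *
      (symbolMatrix φ a ρ t)⁻¹ j i

/-- The reconstruction function `Θ_i`. For a compactly supported `φ` the sum over `v` has only
finitely many nonzero terms at each `t`. -/
def reconstruction (φ : ℝ → ℂ) (a : ℝ) (ρ : ℕ) (i : Fin ρ) (t : ℝ) : ℂ :=
  ∑' v : ℤ, ∑ j : Fin ρ,
    inverseSymbolCoeff φ a ρ j i v * φ (t - (ρ : ℝ) * (v : ℝ) - ((j : ℕ) : ℝ))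

/-- The `l`-th term of the derivative sampling series of `f` at the point `t`. -/
def samplingTerm (φ : ℝ → ℂ) (a : ℝ) (ρ : ℕ) (W : ℝ) (f : ℝ → ℂ) (t : ℝ) (l : ℤ) : ℂ :=
  ∑ i : Fin ρ, (1 / (W : ℂ) ^ (i : ℕ)) *
    iteratedDeriv (i : ℕ) f ((a + (ρ : ℝ) * (l : ℝ)) / W) *
      reconstruction φ a ρ i (W * t - (ρ : ℝ) * (l : ℝ))

/-- The derivative sampling operator `S_W`. -/
def samplingOperator (φ : ℝ → ℂ) (a : ℝ) (ρ : ℕ) (W : ℝ) (f : ℝ → ℂ) (t : ℝ) : ℂ :=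
  ∑' l : ℤ, samplingTerm φ a ρ W f t l

/-- The reproducing polynomial property of order `r`: every `S_W`, `W ≥ 1`, fixes all polynomials
of degree at most `r`. -/
def ReproducesPolynomials (φ : ℝ → ℂ) (a : ℝ) (ρ r : ℕ) : Prop :=
  ∀ W : ℝ, 1 ≤ W → ∀ P : ℂ[X], P.natDegree ≤ r → ∀ t : ℝ,
    samplingOperator φ a ρ W (fun x : ℝ => P.eval (x : ℂ)) t = P.eval (t : ℂ)

/-- The local modulus of smoothness `ω_r(f; x; δ)`, with values in `[0, ∞]`; here
`(fwdDiff h)^[r] f t = ∑_j (-1)^{r-j} (r choose j) f(t + j h)`. -/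
def localModulus (r : ℕ) (f : ℝ → ℂ) (x δ : ℝ) : ℝ≥0∞ :=
  ⨆ (t : ℝ) (h : ℝ) (_ : t ∈ Icc (x - r * δ / 2) (x + r * δ / 2))
    (_ : t + r * h ∈ Icc (x - r * δ / 2) (x + r * δ / 2)), ‖(fwdDiff h)^[r] f t‖ₑ

/-- The averaged modulus of smoothness `τ_r(f; δ)_p`: the `L^p` norm of `x ↦ ω_r(f; x; δ)`,
with values in `[0, ∞]`. -/
def averagedModulus (r : ℕ) (f : ℝ → ℂ) (δ p : ℝ) : ℝ≥0∞ :=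
  eLpNorm (fun x : ℝ => localModulus r f x δ) (ENNReal.ofReal p) volume

/-- Admissible sequences: `0 < inf_j (x_j - x_{j-1})` and `sup_j (x_j - x_{j-1}) < ∞`. -/
def IsAdmissible (x : ℤ → ℝ) : Prop :=
  (∃ m : ℝ, 0 < m ∧ ∀ j : ℤ, m ≤ x j - x (j - 1)) ∧ ∃ M : ℝ, ∀ j : ℤ, x j - x (j - 1) ≤ M

/-- The discrete norm of `f` along the sequence `x`, with values in `[0, ∞]`. -/
def discreteNorm (ρ : ℕ) (p : ℝ) (x : ℤ → ℝ) (f : ℝ → ℂ) : ℝ≥0∞ :=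
  (∑' j : ℤ, ∑ i ∈ Finset.range ρ,
    ‖iteratedDeriv i f (x j)‖ₑ ^ p * ENNReal.ofReal (x j - x (j - 1))) ^ (1 / p)

/-- The space `Λ_ρ^p` of bounded (Lebesgue) measurable functions whose discrete norm is finite
along every admissible sequence. Every real number occurs in an admissible sequence, so that the
derivatives `f^{(i)}`, `i ≤ ρ - 1`, which enter the norm, have to exist at every point; they need
be neither continuous nor bounded. -/
structure MemLambda (ρ : ℕ) (p : ℝ) (f : ℝ → ℂ) : Prop where
  bounded : ∃ C : ℝ, ∀ t : ℝ, ‖f t‖ ≤ C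
  measurable : AEMeasurable f volume
  differentiable : ∀ i : ℕ, i + 1 < ρ → Differentiable ℝ (iteratedDeriv i f)
  discreteNorm_lt_top : ∀ x : ℤ → ℝ, IsAdmissible x → discreteNorm ρ p x f < ∞

end DerivativeSampling

end

namespace DerivativeSampling

/-! ### Finite differences -/

/-! Dilation reduces everything to $W=1$ and $g(x)=f(x/W)$: the factors $W^{-i}$ in $S_W$ are those
of the chain rule, and on the right they are at most $1$. The $L^p$ scaling factor is the same on
both sides.

For $W=1$ the error at $t$ is controlled by polynomial reproduction. Suppose the $r$-th differences
of every $g^{(i)}$, $i<\rho$, with steps in $[0,1/4]$, are at most $A(1+|y-t|)^2$ at each $y$. Then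
a single polynomial $P$ of degree below $r$ satisfies $|g^{(i)}-P^{(i)}|\le CA(1+|y-t|)^{r+2}$ for
all these $i$ (`exists_polynomial_of_fwdDiff_iteratedDeriv_le`). It is a Taylor polynomial of a
combination of iterated Steklov means of $g$. Only $g$ itself is averaged, because the derivatives
need not be integrable; they are recovered from $g$ by a mean value argument
(`norm_deriv_le_of_fwdDiff`).

The inverse symbol is smooth and periodic, so its Fourier coefficients, and with them the
$\Theta_i$, decay faster than any power (`exists_reconstruction_mul_pow_le`). Since $S_1P=P$, the
error is $S_1(g-P)-(g-P)$ at $t$, which is $O(A)$.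

It remains to choose $A$ depending on $t$ with $L^p$ norm bounded by the moduli. A weighted sum of
translates of a modulus constant on cells of length $1/4$ serves: each summand bounds the
differences on one cell, Minkowski's inequality bounds the sum uniformly in $p$, and the cell
modulus is below the local modulus. -/

theorem fwdDiff_iter_eq_alternating_sum (r : ℕ) (h : ℝ) (f : ℝ → ℂ) (y : ℝ) :
    (fwdDiff h)^[r] f y =
      (-1) ^ r * ∑ j ∈ Finset.range (r + 1), (-1) ^ j * (r.choose j : ℂ) * f (y + j * h) := by
  rw [fwdDiff_iter_eq_sum_shift, Finset.mul_sum]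
  refine Finset.sum_congr rfl fun j hj => ?_
  have hj' : j ≤ r := by simpa [Nat.lt_succ_iff] using hj
  have h1 : (-1 : ℂ) ^ r * (-1) ^ j = (-1) ^ (r - j) := by
    obtain ⟨k, rfl⟩ := Nat.exists_eq_add_of_le hj'
    rw [Nat.add_sub_cancel_left, pow_add, mul_right_comm, ← mul_pow]
    simp
  simp only [zsmul_eq_mul, nsmul_eq_mul]
  push_cast
  rw [← h1]
  ring

theorem norm_fwdDiff_iter_eq (r : ℕ) (h : ℝ) (f : ℝ → ℂ) (y : ℝ) :
    ‖(fwdDiff h)^[r] f y‖ =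
      ‖∑ j ∈ Finset.range (r + 1), (-1) ^ j * (r.choose j : ℂ) * f (y + j * h)‖ := by
  rw [fwdDiff_iter_eq_alternating_sum]
  simp

theorem fwdDiff_iter_polynomial_eq_zero {r : ℕ} (h : ℝ) {P : ℂ[X]} (hP : P.natDegree < r)
    (y : ℝ) : (fwdDiff h)^[r] (fun x : ℝ => P.eval (x : ℂ)) y = 0 := by
  -- The substitution $y+hX$ turns steps of length $h$ into unit steps.
  have hQ : (P.comp (Polynomial.C (y : ℂ) + Polynomial.C (h : ℂ) * Polynomial.X)).natDegree < r := by
    refine lt_of_le_of_lt Polynomial.natDegree_comp_le ?_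
    have : (Polynomial.C (y : ℂ) + Polynomial.C (h : ℂ) * Polynomial.X).natDegree ≤ 1 := by
      compute_degree
    nlinarith
  have h0 := congrFun (Polynomial.fwdDiff_iter_eq_zero_of_degree_lt hQ) 0
  rw [fwdDiff_iter_eq_sum_shift] at h0
  rw [fwdDiff_iter_eq_sum_shift]
  refine Eq.trans (Finset.sum_congr rfl fun k _ => ?_) h0
  simp only [Polynomial.eval_comp, Polynomial.eval_add, Polynomial.eval_mul, Polynomial.eval_C,
    Polynomial.eval_X, nsmul_eq_mul, zero_add, mul_one]
  push_cast
  rw [mul_comm (h : ℂ)]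

theorem hasDerivAt_fwdDiff_iter {f f' : ℝ → ℂ} (h : ℝ) (hf : ∀ x, HasDerivAt f (f' x) x) (k : ℕ)
    (x : ℝ) : HasDerivAt ((fwdDiff h)^[k] f) ((fwdDiff h)^[k] f' x) x := by
  induction k generalizing f f' with
  | zero => exact hf x
  | succ k ih =>
    simp only [Function.iterate_succ_apply]
    refine ih fun z => ?_
    exact ((hf (z + h)).comp_add_const z h).sub (hf z)

theorem sum_range_choose_real (r : ℕ) : ∑ j ∈ Finset.range (r + 1), (r.choose j : ℝ) = 2 ^ r := by
  exact_mod_cast Nat.sum_range_choose r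

/-- A derivative whose differences are small is controlled by the values of the function. -/
theorem norm_deriv_le_of_fwdDiff {F F' : ℝ → ℂ} (hF : ∀ x, HasDerivAt F (F' x) x) {r : ℕ}
    {t η M E : ℝ} (hη : 0 < η) (hM : ∀ h ∈ Icc 0 η, ‖(fwdDiff h)^[r] F' t‖ ≤ M)
    (hE : ∀ j ∈ Finset.range (r + 1), ‖F (t + j * η)‖ ≤ E) :
    ‖F' t‖ ≤ M + 2 ^ (r + 1) * E / η := by
  set c : ℕ → ℂ := fun j => (-1) ^ j * (r.choose j : ℂ) with hc
  -- A primitive in $h$ of the alternating sum of $F'(t+jh)$. The mean value inequality for it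
  -- replaces integration, so $F'$ need not be integrable.
  set H : ℝ → ℂ := fun h => h * F' t +
    ∑ j ∈ Finset.range r, c (j + 1) * (F (t + (j + 1 : ℕ) * h) / ((j + 1 : ℕ) : ℂ)) with hH
  have hderiv : ∀ h, HasDerivAt H
      (∑ j ∈ Finset.range (r + 1), c j * F' (t + j * h)) h := by
    intro h
    rw [Finset.sum_range_succ', add_comm]
    have h1 : HasDerivAt (fun h : ℝ => (h : ℂ) * F' t) (c 0 * F' (t + (0 : ℕ) * h)) h := by
      simpa [hc] using (Complex.ofRealCLM.hasDerivAt (x := h)).mul_const (F' t)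
    refine h1.add ?_
    refine HasDerivAt.fun_sum fun j _ => HasDerivAt.const_mul _ ?_
    have h2 : HasDerivAt (fun h : ℝ => t + ((j + 1 : ℕ) : ℝ) * h) ((j + 1 : ℕ) : ℝ) h := by
      simpa using ((hasDerivAt_id h).const_mul ((j + 1 : ℕ) : ℝ)).const_add t
    have h3 := ((hF (t + ((j + 1 : ℕ) : ℝ) * h)).scomp h h2).div_const (((j + 1 : ℕ) : ℝ) : ℂ)
    have h4 : (((j + 1 : ℕ) : ℝ) : ℂ) ≠ 0 := by
      norm_cast
    convert h3 using 1
    · ext z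
      simp
    rw [Complex.real_smul, mul_div_cancel_left₀ _ h4]
  have hbound : ‖H η - H 0‖ ≤ M * ‖η - 0‖ := by
    refine Convex.norm_image_sub_le_of_norm_hasDerivWithin_le
      (f' := fun h => ∑ j ∈ Finset.range (r + 1), c j * F' (t + j * h)) (s := Icc 0 η)
      (fun h _ => (hderiv h).hasDerivWithinAt) ?_ (convex_Icc 0 η) (left_mem_Icc.2 hη.le)
      (right_mem_Icc.2 hη.le)
    intro h hh
    have := hM h hh
    rwa [norm_fwdDiff_iter_eq] at this
  have hE0 : 0 ≤ E := (norm_nonneg _).trans (hE 0 (by simp))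
  have hFt : ‖F t‖ ≤ E := by simpa using hE 0 (by simp)
  have hid : (η : ℂ) * F' t = (H η - H 0) - ∑ j ∈ Finset.range r,
      c (j + 1) * ((F (t + (j + 1 : ℕ) * η) - F t) / ((j + 1 : ℕ) : ℂ)) := by
    simp only [hH, sub_div, mul_sub, Finset.sum_sub_distrib]
    simp
  have hsum : ‖∑ j ∈ Finset.range r,
      c (j + 1) * ((F (t + (j + 1 : ℕ) * η) - F t) / ((j + 1 : ℕ) : ℂ))‖ ≤ 2 ^ (r + 1) * E := by
    calc _ ≤ ∑ j ∈ Finset.range r, (r.choose (j + 1) : ℝ) * (2 * E) := by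
          refine norm_sum_le_of_le _ fun j hj => ?_
          have hj' : j + 1 ∈ Finset.range (r + 1) := by simpa using hj
          rw [norm_mul, norm_div]
          have h5 : ‖c (j + 1)‖ = (r.choose (j + 1) : ℝ) := by simp [hc]
          rw [h5]
          refine mul_le_mul_of_nonneg_left ?_ (by positivity)
          have h6 : ‖F (t + (j + 1 : ℕ) * η) - F t‖ ≤ 2 * E :=
            (norm_sub_le _ _).trans (by linarith [hE _ hj'])
          have h7 : (1 : ℝ) ≤ ‖((j + 1 : ℕ) : ℂ)‖ := by
            rw [Complex.norm_natCast]
            exact_mod_cast Nat.succ_le_succ (Nat.zero_le j)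
          exact (div_le_self (norm_nonneg _) h7).trans h6
      _ ≤ (∑ j ∈ Finset.range (r + 1), (r.choose j : ℝ)) * (2 * E) := by
          rw [Finset.sum_range_succ', ← Finset.sum_mul]
          have : (0 : ℝ) ≤ r.choose 0 := by positivity
          nlinarith
      _ = 2 ^ (r + 1) * E := by rw [sum_range_choose_real]; ring
  have hfin : η * ‖F' t‖ ≤ M * η + 2 ^ (r + 1) * E := by
    have h8 : ‖(η : ℂ) * F' t‖ = η * ‖F' t‖ := by
      rw [norm_mul, Complex.norm_real, Real.norm_of_nonneg hη.le]
    rw [← h8, hid]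
    refine (norm_sub_le _ _).trans (add_le_add ?_ hsum)
    simpa [abs_of_pos hη] using hbound
  have : ‖F' t‖ ≤ (M * η + 2 ^ (r + 1) * E) / η := by
    rw [le_div_iff₀ hη]; linarith
  rwa [add_div, mul_div_cancel_right₀ _ hη.ne'] at this

/-! ### Taylor's formula along a chain of derivatives -/

/-- The derivative of the remainder is the remainder of the shifted chain, so the mean value
inequality gives the induction. The last function of the chain need not be continuous. -/
theorem norm_sub_taylor_le (n : ℕ) (G : ℕ → ℝ → ℂ) (t y B : ℝ)
    (hG : ∀ k < n, ∀ x, HasDerivAt (G k) (G (k + 1) x) x)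
    (hB : ∀ x ∈ uIcc t y, ‖G n x‖ ≤ B) :
    ‖G 0 y - ∑ k ∈ Finset.range n, (((y - t) ^ k / k.factorial : ℝ) : ℂ) * G k t‖ ≤
      B * |y - t| ^ n := by
  have hB0 : 0 ≤ B := (norm_nonneg _).trans (hB t left_mem_uIcc)
  induction n generalizing G y with
  | zero => simpa using hB y right_mem_uIcc
  | succ n ih =>
    set D : ℝ → ℂ := fun x =>
      G 0 x - ∑ k ∈ Finset.range (n + 1), (((x - t) ^ k / k.factorial : ℝ) : ℂ) * G k t with hD
    have hDt : D t = 0 := by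
      simp only [hD, Finset.sum_range_succ']
      simp
    have hderiv : ∀ x, HasDerivAt D (G 1 x -
        ∑ k ∈ Finset.range n, (((x - t) ^ k / k.factorial : ℝ) : ℂ) * G (k + 1) t) x := by
      intro x
      refine (hG 0 (Nat.succ_pos n) x).sub ?_
      simp only [Finset.sum_range_succ']
      have hsum : HasDerivAt (fun x : ℝ => ∑ k ∈ Finset.range n,
          (((x - t) ^ (k + 1) / (k + 1).factorial : ℝ) : ℂ) * G (k + 1) t)
          (∑ k ∈ Finset.range n, (((x - t) ^ k / k.factorial : ℝ) : ℂ) * G (k + 1) t) x := by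
        refine HasDerivAt.fun_sum fun k _ => ?_
        refine HasDerivAt.mul_const (HasDerivAt.ofReal_comp ?_) _
        have h1 := (((hasDerivAt_id x).sub_const t).pow (k + 1)).div_const ((k + 1).factorial : ℝ)
        refine h1.congr_deriv ?_
        rw [Nat.factorial_succ]
        push_cast
        have : (k.factorial : ℝ) ≠ 0 := by positivity
        field_simp
        simp
      simpa using hsum.add_const (G 0 t)
    have key : ∀ x ∈ uIcc t y, ‖G 1 x -
        ∑ k ∈ Finset.range n, (((x - t) ^ k / k.factorial : ℝ) : ℂ) * G (k + 1) t‖ ≤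
        B * |y - t| ^ n := by
      intro x hx
      refine (ih (fun k => G (k + 1)) x (fun k hk => hG (k + 1) (by omega))
        (fun z hz => hB z (uIcc_subset_uIcc_left hx hz))).trans ?_
      exact mul_le_mul_of_nonneg_left
        (pow_le_pow_left₀ (abs_nonneg _) (abs_sub_left_of_mem_uIcc hx) n) hB0
    have := Convex.norm_image_sub_le_of_norm_hasDerivWithin_le (f := D)
      (fun x _ => (hderiv x).hasDerivWithinAt) key (convex_uIcc t y) left_mem_uIcc right_mem_uIcc
    rw [hDt, sub_zero, Real.norm_eq_abs, mul_assoc, ← pow_succ] at this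
    exact this

/-! ### Steklov means -/

/-- Integrability on bounded intervals. -/
def LocallyIntervalIntegrable (g : ℝ → ℂ) : Prop :=
  ∀ a b : ℝ, IntervalIntegrable g volume a b

/-- The mean of `g` over the interval from `x` to `x + s`. -/
noncomputable def stepMean (s : ℝ) (g : ℝ → ℂ) (x : ℝ) : ℂ :=
  ∫ u in (0 : ℝ)..1, g (x + s * u)

theorem LocallyIntervalIntegrable.comp_affine {g : ℝ → ℂ} (hg : LocallyIntervalIntegrable g)
    (x s a b : ℝ) : IntervalIntegrable (fun u => g (x + s * u)) volume a b := by
  rcases eq_or_ne s 0 with rfl | hs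
  · simp
  · have h1 : LocallyIntervalIntegrable fun v => g (x + v) := fun c d => by
      simpa using (hg (x + c) (x + d)).comp_add_left x
    have := (h1 (s * a) (s * b)).comp_mul_left (c := s)
    simpa [hs] using this

theorem stepMean_zero (g : ℝ → ℂ) : stepMean 0 g = g := by
  ext x
  simp [stepMean]

theorem stepMean_eq {g : ℝ → ℂ} (hg : LocallyIntervalIntegrable g) {s : ℝ} (hs : s ≠ 0) (x : ℝ) :
    stepMean s g x = (s : ℂ)⁻¹ * ((∫ y in (0 : ℝ)..(x + s), g y) - ∫ y in (0 : ℝ)..x, g y) := by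
  rw [stepMean, intervalIntegral.integral_comp_add_mul _ hs,
    intervalIntegral.integral_interval_sub_left (hg _ _) (hg _ _)]
  simp

theorem continuous_stepMean {g : ℝ → ℂ} (hg : LocallyIntervalIntegrable g) {s : ℝ} (hs : s ≠ 0) :
    Continuous (stepMean s g) := by
  have h1 := intervalIntegral.continuous_primitive hg 0
  rw [funext (stepMean_eq hg hs)]
  fun_prop

theorem LocallyIntervalIntegrable.stepMean {g : ℝ → ℂ} (hg : LocallyIntervalIntegrable g) (s : ℝ) :
    LocallyIntervalIntegrable (stepMean s g) := by
  rcases eq_or_ne s 0 with rfl | hs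
  · rwa [stepMean_zero]
  · exact fun a b => (continuous_stepMean hg hs).intervalIntegrable a b

theorem LocallyIntervalIntegrable.stepMean_iterate {g : ℝ → ℂ} (hg : LocallyIntervalIntegrable g)
    (s : ℝ) (n : ℕ) : LocallyIntervalIntegrable ((DerivativeSampling.stepMean s)^[n] g) := by
  induction n generalizing g with
  | zero => exact hg
  | succ n ih => exact ih (hg.stepMean s)

theorem hasDerivAt_stepMean {g : ℝ → ℂ} (hg : Continuous g) {s : ℝ} (hs : s ≠ 0) (x : ℝ) :
    HasDerivAt (stepMean s g) ((s : ℂ)⁻¹ * fwdDiff s g x) x := by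
  have hg' : LocallyIntervalIntegrable g := fun a b => hg.intervalIntegrable a b
  have h1 : ∀ z, HasDerivAt (fun u => ∫ y in (0 : ℝ)..u, g y) (g z) z := fun z =>
    intervalIntegral.integral_hasDerivAt_right (hg' _ _)
      (hg.stronglyMeasurableAtFilter _ _) hg.continuousAt
  rw [funext (stepMean_eq hg' hs)]
  exact (((h1 (x + s)).comp_add_const x s).sub (h1 x)).const_mul _

theorem stepMean_fwdDiff_iter {g : ℝ → ℂ} (hg : LocallyIntervalIntegrable g) (s h : ℝ) (r : ℕ)
    (x : ℝ) : (fwdDiff h)^[r] (stepMean s g) x = stepMean s ((fwdDiff h)^[r] g) x := by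
  induction r generalizing g with
  | zero => rfl
  | succ r ih =>
    have h2 : LocallyIntervalIntegrable fun y => g (y + h) := fun a b => by
      simpa [add_comm] using hg.comp_affine h 1 a b
    have h1 : fwdDiff h (stepMean s g) = stepMean s (fwdDiff h g) := by
      ext z
      simp only [fwdDiff, stepMean]
      rw [intervalIntegral.integral_sub (h2.comp_affine z s 0 1) (hg.comp_affine z s 0 1)]
      congr 1
      refine intervalIntegral.integral_congr fun u _ => ?_
      congr 1
      ring
    rw [Function.iterate_succ_apply, Function.iterate_succ_apply, h1]
    exact ih fun a b => (h2 a b).sub (hg a b)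

theorem norm_stepMean_le {g : ℝ → ℂ} {s x M : ℝ} (h : ∀ u ∈ Icc (0 : ℝ) 1, ‖g (x + s * u)‖ ≤ M) :
    ‖stepMean s g x‖ ≤ M := by
  have := intervalIntegral.norm_integral_le_of_norm_le_const (a := 0) (b := 1)
    (f := fun u => g (x + s * u)) (C := M) fun u hu => h u (by
      rw [uIoc_of_le zero_le_one] at hu
      exact Ioc_subset_Icc_self hu)
  simpa [stepMean] using this

/-- The alternating sum of means over intervals of proportional lengths is an average of
finite differences. -/
theorem norm_sum_stepMean_iterate_le {g : ℝ → ℂ} (hg : LocallyIntervalIntegrable g) {r : ℕ}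
    {σ η t M : ℝ} (hσ : 0 ≤ σ) (hM : ∀ h ∈ Icc 0 η, ‖(fwdDiff h)^[r] g t‖ ≤ M) (n : ℕ) :
    ∀ h, 0 ≤ h → h + n * σ ≤ η →
      ‖∑ j ∈ Finset.range (r + 1), (-1) ^ j * (r.choose j : ℂ) *
        (stepMean (j * σ))^[n] g (t + j * h)‖ ≤ M := by
  induction n with
  | zero =>
    intro h h0 h1
    have := hM h ⟨h0, by simpa using h1⟩
    rwa [norm_fwdDiff_iter_eq] at this
  | succ n ih =>
    intro h h0 h1
    set Φ : ℝ → ℂ := fun h => ∑ j ∈ Finset.range (r + 1), (-1) ^ j * (r.choose j : ℂ) *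
        (stepMean (j * σ))^[n] g (t + j * h) with hΦ
    -- Averaging over $h$ in an interval of length $\sigma$ moves the argument $t+jh$ over length
    -- $j\sigma$, so it adds one mean of length $j\sigma$ to each summand.
    have hEq : ∑ j ∈ Finset.range (r + 1), (-1) ^ j * (r.choose j : ℂ) *
        (stepMean (j * σ))^[n + 1] g (t + j * h) = stepMean σ Φ h := by
      have hii : ∀ j : ℕ, IntervalIntegrable
          (fun u => (stepMean (j * σ))^[n] g (t + j * (h + σ * u))) volume 0 1 := fun j => by
        have := (hg.stepMean_iterate (j * σ) n).comp_affine (t + j * h) (j * σ) 0 1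
        refine this.congr fun u _ => ?_
        ring_nf
      simp only [stepMean, hΦ]
      rw [intervalIntegral.integral_finsetSum fun j _ => (hii j).const_mul _]
      refine Finset.sum_congr rfl fun j _ => ?_
      rw [intervalIntegral.integral_const_mul, Function.iterate_succ_apply']
      congr 1
      refine intervalIntegral.integral_congr fun u _ => ?_
      ring_nf
    rw [hEq]
    refine norm_stepMean_le fun u hu => ih (h + σ * u) (by nlinarith [hu.1]) ?_
    push_cast at h1
    nlinarith [hu.2]

/-- The `k`-th derivative of the iterated Steklov mean of order `n + k`, expressed by differences
of the mean of order `n`. -/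
theorem hasDerivAt_fwdDiff_stepMean_iterate {g : ℝ → ℂ} (hg : LocallyIntervalIntegrable g) {s : ℝ}
    (hs : s ≠ 0) (k n : ℕ) (x : ℝ) :
    HasDerivAt (fun x => ((s : ℂ)⁻¹) ^ k * (fwdDiff s)^[k] ((stepMean s)^[n + 2] g) x)
      (((s : ℂ)⁻¹) ^ (k + 1) * (fwdDiff s)^[k + 1] ((stepMean s)^[n + 1] g) x) x := by
  have hcont : Continuous ((stepMean s)^[n + 1] g) := by
    rw [Function.iterate_succ_apply']
    exact continuous_stepMean (hg.stepMean_iterate s n) hs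
  have h1 : ∀ z, HasDerivAt ((stepMean s)^[n + 2] g)
      (((s : ℂ)⁻¹ • fwdDiff s ((stepMean s)^[n + 1] g)) z) z := fun z => by
    rw [Function.iterate_succ_apply']
    exact hasDerivAt_stepMean hcont hs z
  have h2 := (hasDerivAt_fwdDiff_iter s h1 k x).const_mul (((s : ℂ)⁻¹) ^ k)
  have h3 : (fwdDiff s)^[k] ((s : ℂ)⁻¹ • fwdDiff s ((stepMean s)^[n + 1] g)) x =
      (s : ℂ)⁻¹ * (fwdDiff s)^[k + 1] ((stepMean s)^[n + 1] g) x := by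
    rw [fwdDiff_iter_const_smul, Function.iterate_succ_apply]
    rfl
  rwa [h3, ← mul_assoc, ← pow_succ] at h2

/-! ### Polynomial approximation controlled by finite differences -/

/-- In the averaged $r$-th difference the term $j=0$ is $g$ itself, and the terms $j\ge1$ form a
smooth function up to sign. That function is close to $g$ and has a small $r$-th derivative, so its
Taylor polynomial at $t$ is close to $g$. -/
theorem exists_polynomial_of_fwdDiff_le {r : ℕ} (hr : 1 ≤ r) :
    ∃ C : ℝ, 1 ≤ C ∧ ∀ g : ℝ → ℂ, LocallyIntervalIntegrable g → ∀ t A : ℝ, 0 ≤ A →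
      (∀ y, ∀ h ∈ Icc (0 : ℝ) (1 / 4), ‖(fwdDiff h)^[r] g y‖ ≤ A * (1 + |y - t|) ^ 2) →
      ∃ P : ℂ[X], P.natDegree < r ∧
        ∀ y : ℝ, ‖g y - P.eval (y : ℂ)‖ ≤ C * A * (1 + |y - t|) ^ (r + 2) := by
  -- With $r+1$ averagings the steps of the differences stay within $[0,(r+1)\sigma]=[0,1/4]$.
  set σ : ℝ := 1 / (4 * (r + 1)) with hσ
  have hσ0 : 0 < σ := by positivity
  have hσ1 : (r + 1) * σ = 1 / 4 := by
    rw [hσ]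
    field_simp
  set s : ℕ → ℝ := fun j => ((j + 1 : ℕ) : ℝ) * σ with hs
  have hs0 : ∀ j, 0 < s j := fun j => by
    simp only [hs]
    positivity
  set K : ℝ := ∑ j ∈ Finset.range r, (r.choose (j + 1) : ℝ) * ((s j)⁻¹) ^ r with hK
  have hK0 : 0 ≤ K := Finset.sum_nonneg fun j _ => by
    have := hs0 j
    positivity
  refine ⟨1 + 4 * K, by linarith, fun g hg t A hA hΔ => ?_⟩
  -- `G k` is the $k$-th derivative of `G 0`: each differentiation trades one mean for a difference
  -- quotient. Starting from $r+1$ means leaves one at $k=r$, so all $r$ derivatives exist at every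
  -- point although $g$ may be discontinuous.
  set G : ℕ → ℝ → ℂ := fun k x => ∑ j ∈ Finset.range r, ((-1) ^ j * (r.choose (j + 1) : ℂ)) *
    (((s j : ℂ)⁻¹) ^ k * (fwdDiff (s j))^[k] ((stepMean (s j))^[r + 1 - k] g) x) with hG
  have hGd : ∀ k < r, ∀ x, HasDerivAt (G k) (G (k + 1) x) x := by
    intro k hk x
    refine HasDerivAt.fun_sum fun j _ => HasDerivAt.const_mul _ ?_
    obtain ⟨n, rfl⟩ : ∃ n, r = k + 1 + n := Nat.exists_eq_add_of_le hk
    have := hasDerivAt_fwdDiff_stepMean_iterate hg (hs0 j).ne' k n x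
    convert this using 4 <;> congr 3 <;> omega
  have hg0 : ∀ y, ‖g y - G 0 y‖ ≤ A * (1 + |y - t|) ^ 2 := by
    intro y
    have h1 := norm_sum_stepMean_iterate_le hg hσ0.le (hΔ y) (r + 1) 0 le_rfl
      (by push_cast; linarith)
    rw [Finset.sum_range_succ'] at h1
    convert h1 using 2
    -- For $j=0$ the means have length zero and leave $g$ unchanged.
    rw [Nat.cast_zero, zero_mul, Function.iterate_fixed (stepMean_zero g), add_comm, sub_eq_add_neg]
    congr 1
    · simp
    · simp only [hG, hs, ← Finset.sum_neg_distrib]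
      refine Finset.sum_congr rfl fun j _ => ?_
      simp only [pow_zero, one_mul, Function.iterate_zero, id, Nat.sub_zero, mul_zero, add_zero,
        pow_succ]
      ring
  have hGr : ∀ x, ‖G r x‖ ≤ 4 * K * A * (1 + |x - t|) ^ 2 := by
    intro x
    have h1 : ∀ j ∈ Finset.range r, ‖((-1) ^ j * (r.choose (j + 1) : ℂ)) *
        (((s j : ℂ)⁻¹) ^ r * (fwdDiff (s j))^[r] ((stepMean (s j))^[r + 1 - r] g) x)‖ ≤
        ((r.choose (j + 1) : ℝ) * ((s j)⁻¹) ^ r) * (4 * A * (1 + |x - t|) ^ 2) := by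
      intro j hj
      have hjr : ((j + 1 : ℕ) : ℝ) ≤ r := by
        exact_mod_cast Finset.mem_range.1 hj
      have hsj : s j ≤ 1 / 4 := by
        simp only [hs]
        nlinarith
      rw [Nat.add_sub_cancel_left, Function.iterate_one, stepMean_fwdDiff_iter hg]
      have h2 : ‖stepMean (s j) ((fwdDiff (s j))^[r] g) x‖ ≤ 4 * A * (1 + |x - t|) ^ 2 := by
        refine norm_stepMean_le fun u hu => (hΔ _ _ ⟨(hs0 j).le, hsj⟩).trans ?_
        have h3 : |x + s j * u - t| ≤ 1 + |x - t| := by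
          have h4 : |s j * u| ≤ 1 := by
            rw [abs_of_nonneg (mul_nonneg (hs0 j).le hu.1)]
            nlinarith [hu.1, hu.2, hs0 j]
          calc |x + s j * u - t| = |s j * u + (x - t)| := by ring_nf
            _ ≤ _ := (abs_add_le _ _).trans (by linarith)
        have h5 : (1 + |x + s j * u - t|) ^ 2 ≤ (2 * (1 + |x - t|)) ^ 2 := by
          have := abs_nonneg (x - t)
          gcongr
          linarith
        calc _ ≤ A * (2 * (1 + |x - t|)) ^ 2 := by gcongr
          _ = _ := by ring
      rw [norm_mul, norm_mul, norm_mul, norm_pow, norm_pow, norm_inv, Complex.norm_real,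
        Real.norm_of_nonneg (hs0 j).le, Complex.norm_natCast, norm_neg, norm_one, one_pow, one_mul,
        ← mul_assoc]
      have := hs0 j
      gcongr
    refine (norm_sum_le_of_le _ h1).trans (le_of_eq ?_)
    rw [← Finset.sum_mul, ← hK]
    ring
  refine ⟨∑ k ∈ Finset.range r, Polynomial.C (G k t / k.factorial) *
    (Polynomial.X - Polynomial.C (t : ℂ)) ^ k, ?_, fun y => ?_⟩
  · refine lt_of_le_of_lt (Polynomial.natDegree_sum_le_of_forall_le (n := r - 1) _ _ ?_) (by omega)
    intro k hk
    refine (Polynomial.natDegree_C_mul_le _ _).trans (Polynomial.natDegree_pow_le.trans ?_)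
    rw [Polynomial.natDegree_X_sub_C]
    have := Finset.mem_range.1 hk
    omega
  · have hT := norm_sub_taylor_le r G t y (4 * K * A * (1 + |y - t|) ^ 2) hGd fun x hx =>
      (hGr x).trans (by
        have h1 : |x - t| ≤ |y - t| := abs_sub_left_of_mem_uIcc hx
        gcongr)
    have hP : Polynomial.eval (y : ℂ) (∑ k ∈ Finset.range r, Polynomial.C (G k t / k.factorial) *
        (Polynomial.X - Polynomial.C (t : ℂ)) ^ k) =
        ∑ k ∈ Finset.range r, (((y - t) ^ k / k.factorial : ℝ) : ℂ) * G k t := by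
      rw [Polynomial.eval_finsetSum]
      refine Finset.sum_congr rfl fun k _ => ?_
      simp only [Polynomial.eval_mul, Polynomial.eval_C, Polynomial.eval_pow, Polynomial.eval_sub,
        Polynomial.eval_X]
      push_cast
      ring
    rw [hP]
    set T := ∑ k ∈ Finset.range r, (((y - t) ^ k / k.factorial : ℝ) : ℂ) * G k t
    have habs := abs_nonneg (y - t)
    have h2 : (1 + |y - t|) ^ 2 ≤ (1 + |y - t|) ^ (r + 2) :=
      pow_le_pow_right₀ (by linarith) (by omega)
    have h3 : |y - t| ^ r ≤ (1 + |y - t|) ^ r := by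
      gcongr
      linarith
    calc ‖g y - T‖ = ‖(g y - G 0 y) + (G 0 y - T)‖ := by ring_nf
      _ ≤ A * (1 + |y - t|) ^ 2 + 4 * K * A * (1 + |y - t|) ^ 2 * |y - t| ^ r :=
        (norm_add_le _ _).trans (add_le_add (hg0 y) hT)
      _ ≤ A * (1 + |y - t|) ^ (r + 2) + 4 * K * A * (1 + |y - t|) ^ 2 * (1 + |y - t|) ^ r := by
        gcongr
      _ = _ := by ring

/-- Induction along the chain by `norm_deriv_le_of_fwdDiff` with $\eta=1/4$. The power $2^{r+3}$ is
$2^{r+1}/\eta$, and $(1+r)^{r+2}$ pays for moving the weight from $y$ to $y+j/4$. -/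
theorem norm_le_of_fwdDiff_of_chain {r N : ℕ} {F : ℕ → ℝ → ℂ} {t A C : ℝ} (hA : 0 ≤ A) (hC : 1 ≤ C)
    (hF : ∀ i < N, ∀ x, HasDerivAt (F i) (F (i + 1) x) x)
    (hΔ : ∀ i ≤ N, ∀ y, ∀ h ∈ Icc (0 : ℝ) (1 / 4),
      ‖(fwdDiff h)^[r] (F i) y‖ ≤ A * (1 + |y - t|) ^ 2)
    (h0 : ∀ y, ‖F 0 y‖ ≤ C * A * (1 + |y - t|) ^ (r + 2)) :
    ∀ i ≤ N, ∀ y, ‖F i y‖ ≤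
      C * (1 + 2 ^ (r + 3) * (1 + r : ℝ) ^ (r + 2)) ^ i * A * (1 + |y - t|) ^ (r + 2) := by
  set L : ℝ := 2 ^ (r + 3) * (1 + r : ℝ) ^ (r + 2) with hL
  have hL0 : 0 ≤ L := by positivity
  intro i
  induction i with
  | zero => intro _ y; simpa using h0 y
  | succ i ih =>
    intro hi y
    have habs := abs_nonneg (y - t)
    set D : ℝ := C * (1 + L) ^ i with hD
    have hD1 : 1 ≤ D := one_le_mul_of_one_le_of_one_le hC (one_le_pow₀ (by linarith))
    have h1 := norm_deriv_le_of_fwdDiff (hF i (by omega)) (r := r) (t := y) (η := 1 / 4)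
      (by norm_num) (hΔ (i + 1) hi y) (E := D * A * ((1 + r) * (1 + |y - t|)) ^ (r + 2)) (by
        intro j hj
        refine (ih (by omega) _).trans ?_
        have hjr : (j : ℝ) ≤ r := by
          exact_mod_cast Nat.lt_succ_iff.1 (Finset.mem_range.1 hj)
        have h3 : |y + j * (1 / 4) - t| ≤ j + |y - t| := by
          have hj0 : (0 : ℝ) ≤ j := by positivity
          calc |y + j * (1 / 4) - t| = |j * (1 / 4) + (y - t)| := by ring_nf
            _ ≤ |(j : ℝ) * (1 / 4)| + |y - t| := abs_add_le _ _
            _ ≤ _ := by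
              rw [abs_of_nonneg (by positivity)]
              linarith
        have h4 : 1 + |y + j * (1 / 4) - t| ≤ (1 + r) * (1 + |y - t|) := by
          have hr0 : (0 : ℝ) ≤ r := by positivity
          nlinarith
        gcongr)
    have h2 : (1 + |y - t|) ^ 2 ≤ (1 + |y - t|) ^ (r + 2) :=
      pow_le_pow_right₀ (by linarith) (by omega)
    calc ‖F (i + 1) y‖ ≤ A * (1 + |y - t|) ^ 2 +
          2 ^ (r + 1) * (D * A * ((1 + r) * (1 + |y - t|)) ^ (r + 2)) / (1 / 4) := h1
      _ = A * (1 + |y - t|) ^ 2 + L * D * A * (1 + |y - t|) ^ (r + 2) := by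
        rw [hL, mul_pow]
        ring
      _ ≤ D * A * (1 + |y - t|) ^ (r + 2) + L * D * A * (1 + |y - t|) ^ (r + 2) := by
        gcongr
        nlinarith
      _ = _ := by
        rw [hD, pow_succ]
        ring

theorem hasDerivAt_polynomial (P : ℂ[X]) (x : ℝ) :
    HasDerivAt (fun x : ℝ => P.eval (x : ℂ)) (P.derivative.eval (x : ℂ)) x :=
  (P.hasDerivAt (x : ℂ)).comp_ofReal

theorem iteratedDeriv_polynomial (P : ℂ[X]) (i : ℕ) :
    iteratedDeriv i (fun x : ℝ => P.eval (x : ℂ)) =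
      fun x : ℝ => (Polynomial.derivative^[i] P).eval (x : ℂ) := by
  induction i with
  | zero => simp
  | succ i ih =>
    rw [iteratedDeriv_succ, ih]
    ext x
    rw [(hasDerivAt_polynomial _ x).deriv, Function.iterate_succ_apply']

/-- The polynomial found for $g$ works for all derivatives: $r$-th differences annihilate its
derivatives, so the functions $g^{(i)}-P^{(i)}$ form a chain with the same difference bounds. -/
theorem exists_polynomial_of_fwdDiff_iteratedDeriv_le {r : ℕ} (hr : 1 ≤ r) (ρ : ℕ) :
    ∃ C : ℝ, 0 ≤ C ∧ ∀ g : ℝ → ℂ, LocallyIntervalIntegrable g →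
      (∀ i : ℕ, i + 1 < ρ → Differentiable ℝ (iteratedDeriv i g)) → ∀ t A : ℝ, 0 ≤ A →
      (∀ i < ρ, ∀ y, ∀ h ∈ Icc (0 : ℝ) (1 / 4),
        ‖(fwdDiff h)^[r] (iteratedDeriv i g) y‖ ≤ A * (1 + |y - t|) ^ 2) →
      ∃ P : ℂ[X], P.natDegree < r ∧ ∀ i < ρ, ∀ y : ℝ,
        ‖iteratedDeriv i g y - iteratedDeriv i (fun x : ℝ => P.eval (x : ℂ)) y‖ ≤
          C * A * (1 + |y - t|) ^ (r + 2) := by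
  obtain ⟨C, hC, H⟩ := exists_polynomial_of_fwdDiff_le hr
  set L : ℝ := 1 + 2 ^ (r + 3) * (1 + r : ℝ) ^ (r + 2) with hL
  have hL1 : 1 ≤ L := by
    rw [hL]
    have : (0 : ℝ) ≤ 2 ^ (r + 3) * (1 + r : ℝ) ^ (r + 2) := by positivity
    linarith
  refine ⟨C * L ^ ρ, by positivity, fun g hg hd t A hA hΔ => ?_⟩
  rcases Nat.eq_zero_or_pos ρ with rfl | hρ
  · exact ⟨0, by rwa [Polynomial.natDegree_zero], fun i hi => absurd hi (Nat.not_lt_zero i)⟩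
  obtain ⟨P, hP, hgP⟩ := H g hg t A hA (by simpa using hΔ 0 hρ)
  refine ⟨P, hP, ?_⟩
  set F : ℕ → ℝ → ℂ := fun i y =>
    iteratedDeriv i g y - (Polynomial.derivative^[i] P).eval (y : ℂ) with hF
  have hdeg : ∀ i, (Polynomial.derivative^[i] P).natDegree < r := fun i =>
    (Polynomial.natDegree_iterate_derivative P i).trans_lt (by omega)
  have hFd : ∀ i < ρ - 1, ∀ x, HasDerivAt (F i) (F (i + 1) x) x := by
    intro i hi x
    refine HasDerivAt.sub ?_ ?_
    · rw [iteratedDeriv_succ]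
      exact (hd i (by omega) x).hasDerivAt
    · rw [Function.iterate_succ_apply']
      exact hasDerivAt_polynomial _ x
  have hFΔ : ∀ i ≤ ρ - 1, ∀ y, ∀ h ∈ Icc (0 : ℝ) (1 / 4),
      ‖(fwdDiff h)^[r] (F i) y‖ ≤ A * (1 + |y - t|) ^ 2 := by
    intro i hi y h hh
    have h1 : (fwdDiff h)^[r] (F i) y = (fwdDiff h)^[r] (iteratedDeriv i g) y -
        (fwdDiff h)^[r] (fun x : ℝ => (Polynomial.derivative^[i] P).eval (x : ℂ)) y := by
      simp only [fwdDiff_iter_eq_alternating_sum, hF, mul_sub, Finset.sum_sub_distrib]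
    rw [h1, fwdDiff_iter_polynomial_eq_zero h (hdeg i), sub_zero]
    exact hΔ i (by omega) y h hh
  have h2 := norm_le_of_fwdDiff_of_chain hA hC hFd hFΔ (by simpa [hF] using hgP)
  intro i hi y
  rw [iteratedDeriv_polynomial]
  refine (h2 i (by omega) y).trans ?_
  have : L ^ i ≤ L ^ ρ := pow_le_pow_right₀ hL1 hi.le
  rw [← hL]
  have := abs_nonneg (y - t)
  gcongr

/-! ### Decay of Fourier coefficients -/

/-- Integration by parts; periodicity cancels the boundary terms. -/
theorem fourier_integral_deriv {H : ℝ → ℂ} (hH : ContDiff ℝ 1 H) (hper : Function.Periodic H 1)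
    (v : ℤ) :
    ∫ t in (0 : ℝ)..1, Complex.exp (-(2 * (Real.pi : ℂ) * Complex.I * (v : ℂ) * (t : ℂ))) *
        deriv H t =
      (2 * (Real.pi : ℂ) * Complex.I * (v : ℂ)) *
        ∫ t in (0 : ℝ)..1, Complex.exp (-(2 * (Real.pi : ℂ) * Complex.I * (v : ℂ) * (t : ℂ))) *
          H t := by
  set z : ℂ := 2 * (Real.pi : ℂ) * Complex.I * (v : ℂ) with hz
  have hexp : ∀ t : ℝ, HasDerivAt (fun t : ℝ => Complex.exp (-(z * t)))
      (-z * Complex.exp (-(z * t))) t := by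
    intro t
    have h1 : HasDerivAt (fun t : ℝ => -(z * (t : ℂ))) (-(z * 1)) t :=
      ((Complex.ofRealCLM.hasDerivAt (x := t)).const_mul z).neg
    convert h1.cexp using 1
    ring
  have hH' : Continuous (deriv H) := hH.continuous_deriv le_rfl
  have hE' : Continuous fun t : ℝ => -z * Complex.exp (-(z * t)) := by fun_prop
  rw [intervalIntegral.integral_mul_deriv_eq_deriv_mul (fun t _ => hexp t)
    (fun t _ => (hH.differentiable one_ne_zero t).hasDerivAt)
    (hE'.intervalIntegrable _ _) (hH'.intervalIntegrable _ _)]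
  have h1 : H 1 = H 0 := by simpa using hper 0
  have h2 : Complex.exp (-z) = 1 := by
    rw [hz, Complex.exp_eq_one_iff]
    exact ⟨-v, by push_cast; ring⟩
  simp only [Complex.ofReal_one, mul_one, Complex.ofReal_zero, mul_zero, neg_zero, Complex.exp_zero,
    h1, h2, sub_self, zero_sub, neg_mul, mul_assoc, intervalIntegral.integral_neg,
    intervalIntegral.integral_const_mul, neg_neg]

theorem exists_fourier_integral_mul_pow_le (N : ℕ) {H : ℝ → ℂ} (hH : ContDiff ℝ (⊤ : ℕ∞) H)
    (hper : Function.Periodic H 1) :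
    ∃ C : ℝ, ∀ v : ℤ, ‖∫ t in (0 : ℝ)..1,
      Complex.exp (-(2 * (Real.pi : ℂ) * Complex.I * (v : ℂ) * (t : ℂ))) * H t‖ * |(v : ℝ)| ^ N ≤
        C := by
  induction N generalizing H with
  | zero =>
    obtain ⟨C, hC⟩ := isCompact_Icc.exists_bound_of_continuousOn (s := Icc (0 : ℝ) 1)
      hH.continuous.continuousOn
    refine ⟨C, fun v => ?_⟩
    have := intervalIntegral.norm_integral_le_of_norm_le_const (a := 0) (b := 1) (C := C)
      (f := fun t : ℝ =>
        Complex.exp (-(2 * (Real.pi : ℂ) * Complex.I * (v : ℂ) * (t : ℂ))) * H t) fun t ht => by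
        rw [uIoc_of_le zero_le_one] at ht
        have h1 : -(2 * (Real.pi : ℂ) * Complex.I * (v : ℂ) * (t : ℂ)) =
            ((-(2 * Real.pi * v * t) : ℝ) : ℂ) * Complex.I := by
          push_cast
          ring
        rw [norm_mul, h1, Complex.norm_exp_ofReal_mul_I, one_mul]
        exact hC t (Ioc_subset_Icc_self ht)
    simpa using this
  | succ N ih =>
    have hH' : ContDiff ℝ (⊤ : ℕ∞) (deriv H) := (contDiff_infty_iff_deriv.1 hH).2
    have hper' : Function.Periodic (deriv H) 1 := fun x => by
      rw [← deriv_comp_add_const, funext hper]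
    obtain ⟨C, hC⟩ := ih hH' hper'
    refine ⟨C, fun v => le_trans ?_ (hC v)⟩
    rw [fourier_integral_deriv (hH.of_le (by exact_mod_cast le_top)) hper v, norm_mul, pow_succ,
      mul_comm (|(v : ℝ)| ^ N), ← mul_assoc, mul_comm _ |(v : ℝ)|]
    gcongr
    simp only [norm_mul, Complex.norm_real, Complex.norm_I, Complex.norm_intCast, mul_one]
    have h1 : (1 : ℝ) ≤ ‖(2 : ℂ)‖ * ‖Real.pi‖ := by
      rw [Real.norm_of_nonneg Real.pi_pos.le]
      simp
      linarith [Real.pi_gt_three]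
    exact le_mul_of_one_le_left (abs_nonneg _) h1

theorem exists_fourier_integral_mul_one_add_pow_le (N : ℕ) {H : ℝ → ℂ}
    (hH : ContDiff ℝ (⊤ : ℕ∞) H) (hper : Function.Periodic H 1) :
    ∃ C : ℝ, ∀ v : ℤ, ‖∫ t in (0 : ℝ)..1,
      Complex.exp (-(2 * (Real.pi : ℂ) * Complex.I * (v : ℂ) * (t : ℂ))) * H t‖ *
        (1 + |(v : ℝ)|) ^ N ≤ C := by
  obtain ⟨C₀, h₀⟩ := exists_fourier_integral_mul_pow_le 0 hH hper
  obtain ⟨C, hC⟩ := exists_fourier_integral_mul_pow_le N hH hper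
  refine ⟨2 ^ N * (C₀ + C), fun v => ?_⟩
  have h1 := h₀ v
  have h2 := hC v
  set I := ‖∫ t in (0 : ℝ)..1,
      Complex.exp (-(2 * (Real.pi : ℂ) * Complex.I * (v : ℂ) * (t : ℂ))) * H t‖
  have hI : 0 ≤ I := norm_nonneg _
  have hv := abs_nonneg (v : ℝ)
  have h3 : (1 + |(v : ℝ)|) ^ N ≤ 2 ^ N * (1 + |(v : ℝ)| ^ N) := by
    rcases le_total |(v : ℝ)| 1 with h | h
    · have : (1 + |(v : ℝ)|) ^ N ≤ 2 ^ N := by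
        gcongr
        linarith
      have : (0 : ℝ) ≤ 2 ^ N * |(v : ℝ)| ^ N := by positivity
      linarith
    · have : (1 + |(v : ℝ)|) ^ N ≤ (2 * |(v : ℝ)|) ^ N := by
        gcongr
        linarith
      rw [mul_pow] at this
      have : (0 : ℝ) ≤ 2 ^ N := by positivity
      linarith
  calc I * (1 + |(v : ℝ)|) ^ N ≤ I * (2 ^ N * (1 + |(v : ℝ)| ^ N)) := by gcongr
    _ = 2 ^ N * (I * |(v : ℝ)| ^ 0 + I * |(v : ℝ)| ^ N) := by ring
    _ ≤ _ := by gcongr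

/-! ### Smoothness of the inverse symbol -/

theorem exists_eq_zero_of_lt_abs {f : ℝ → ℂ} (hf : HasCompactSupport f) :
    ∃ R : ℝ, 0 ≤ R ∧ ∀ x, R < |x| → f x = 0 := by
  obtain ⟨R, hR⟩ := hf.isCompact.isBounded.subset_closedBall 0
  refine ⟨max R 0, le_max_right _ _, fun x hx => image_eq_zero_of_notMem_tsupport fun h => ?_⟩
  have := hR h
  rw [mem_closedBall_zero_iff, Real.norm_eq_abs] at this
  exact absurd (this.trans (le_max_left R 0)) (not_le.2 hx)

theorem hasCompactSupport_iteratedDeriv {f : ℝ → ℂ} (hf : HasCompactSupport f) (i : ℕ) :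
    HasCompactSupport (iteratedDeriv i f) := by
  induction i with
  | zero => simpa using hf
  | succ i ih =>
    rw [iteratedDeriv_succ]
    exact ih.deriv

/-- Compact support leaves finitely many $k$, so each entry is a trigonometric polynomial. -/
theorem contDiff_symbolMatrix {φ : ℝ → ℂ} (hφ : HasCompactSupport φ) (a : ℝ) {ρ : ℕ} (hρ : 1 ≤ ρ)
    (i j : Fin ρ) : ContDiff ℝ (⊤ : ℕ∞) fun t => symbolMatrix φ a ρ t i j := by
  obtain ⟨R, hR0, hR⟩ := exists_eq_zero_of_lt_abs (hasCompactSupport_iteratedDeriv hφ i)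
  set K : ℕ := ⌈R + |a| + (j : ℕ)⌉₊ with hK
  have hK' : R + |a| + (j : ℕ) ≤ K := Nat.le_ceil _
  have hEq : (fun t => symbolMatrix φ a ρ t i j) = fun t : ℝ => ∑ k ∈ Finset.Icc (-(K : ℤ)) K,
      iteratedDeriv (i : ℕ) φ (a + (ρ : ℝ) * (k : ℝ) - ((j : ℕ) : ℝ)) *
        Complex.exp (2 * (Real.pi : ℂ) * Complex.I * (k : ℂ) * (t : ℂ)) := by
    ext t
    simp only [symbolMatrix, Matrix.of_apply]
    refine tsum_eq_sum fun k hk => ?_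
    rw [hR _ ?_, zero_mul]
    have h1 : (K : ℝ) < |(k : ℝ)| := by
      rw [Finset.mem_Icc, ← abs_le, not_le] at hk
      exact_mod_cast hk
    have h2 : |(k : ℝ)| ≤ |(ρ : ℝ) * k| := by
      rw [abs_mul, Nat.abs_cast]
      exact le_mul_of_one_le_left (abs_nonneg _) (by exact_mod_cast hρ)
    have h3 : |(ρ : ℝ) * k| ≤ |a + (ρ : ℝ) * k - (j : ℕ)| + |a| + (j : ℕ) := by
      calc |(ρ : ℝ) * k| = |(a + (ρ : ℝ) * k - (j : ℕ)) - a + (j : ℕ)| := by ring_nf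
        _ ≤ |(a + (ρ : ℝ) * k - (j : ℕ)) - a| + |((j : ℕ) : ℝ)| := abs_add_le _ _
        _ ≤ _ := by
          rw [Nat.abs_cast]
          gcongr
          exact abs_sub _ _
    linarith
  rw [hEq]
  refine ContDiff.sum fun k _ => contDiff_const.mul (ContDiff.cexp ?_)
  exact contDiff_const.mul Complex.ofRealCLM.contDiff

theorem periodic_symbolMatrix (φ : ℝ → ℂ) (a : ℝ) (ρ : ℕ) :
    Function.Periodic (symbolMatrix φ a ρ) 1 := by
  intro t
  ext i j
  simp only [symbolMatrix, Matrix.of_apply]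
  refine tsum_congr fun k => ?_
  congr 1
  rw [Complex.exp_eq_exp_iff_exists_int]
  exact ⟨k, by push_cast; ring⟩

theorem contDiff_det {ρ : ℕ} {M : ℝ → Matrix (Fin ρ) (Fin ρ) ℂ}
    (hM : ∀ i j, ContDiff ℝ (⊤ : ℕ∞) fun t => M t i j) :
    ContDiff ℝ (⊤ : ℕ∞) fun t => (M t).det := by
  simp only [Matrix.det_apply']
  exact ContDiff.sum fun σ _ => contDiff_const.mul (contDiff_prod fun i _ => hM _ _)

/-- Cramer's rule. -/
theorem contDiff_inverse {ρ : ℕ} {M : ℝ → Matrix (Fin ρ) (Fin ρ) ℂ}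
    (hM : ∀ i j, ContDiff ℝ (⊤ : ℕ∞) fun t => M t i j) (hdet : ∀ t, (M t).det ≠ 0) (i j : Fin ρ) :
    ContDiff ℝ (⊤ : ℕ∞) fun t => (M t)⁻¹ i j := by
  simp only [Matrix.inv_def, Matrix.smul_apply, Ring.inverse_eq_inv', smul_eq_mul,
    Matrix.adjugate_apply]
  refine ((contDiff_det hM).inv hdet).mul (contDiff_det fun k l => ?_)
  by_cases hk : k = j
  · simpa [Matrix.updateRow_apply, hk] using contDiff_const
  · simpa [Matrix.updateRow_apply, hk] using hM k l

theorem exists_inverseSymbolCoeff_mul_pow_le {φ : ℝ → ℂ} (hφ : HasCompactSupport φ) (a : ℝ) {ρ : ℕ}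
    (hρ : 1 ≤ ρ) (hdet : ∀ t ∈ Icc (0 : ℝ) 1, (symbolMatrix φ a ρ t).det ≠ 0) (N : ℕ)
    (j i : Fin ρ) :
    ∃ C : ℝ, ∀ v : ℤ, ‖inverseSymbolCoeff φ a ρ j i v‖ * (1 + |(v : ℝ)|) ^ N ≤ C := by
  have hper := periodic_symbolMatrix φ a ρ
  have hdet' : ∀ t, (symbolMatrix φ a ρ t).det ≠ 0 := fun t => by
    have h1 : symbolMatrix φ a ρ t = symbolMatrix φ a ρ (Int.fract t) := by
      have := hper.sub_int_mul_eq (x := t) ⌊t⌋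
      rw [mul_one] at this
      exact this.symm
    rw [h1]
    exact hdet _ ⟨Int.fract_nonneg t, (Int.fract_lt_one t).le⟩
  exact exists_fourier_integral_mul_one_add_pow_le N
    (contDiff_inverse (contDiff_symbolMatrix hφ a hρ) hdet' j i)
    fun t => by rw [hper t]

/-! ### Decay of the reconstruction functions -/

theorem summable_int_one_add_abs_sq_inv : Summable fun v : ℤ => ((1 + |(v : ℝ)|) ^ 2)⁻¹ := by
  have h : Summable fun n : ℕ => ((1 + (n : ℝ)) ^ 2)⁻¹ := by
    have := (summable_nat_add_iff 1).2 (Real.summable_nat_pow_inv.2 one_lt_two)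
    refine this.congr fun n => ?_
    push_cast
    rw [add_comm]
  rw [summable_int_iff_summable_nat_and_neg]
  exact ⟨h.congr fun n => by simp, h.congr fun n => by simp⟩

theorem exists_reconstruction_mul_pow_le {φ : ℝ → ℂ} (hφ : HasCompactSupport φ)
    (hφc : Continuous φ) (a : ℝ) {ρ : ℕ} (hρ : 1 ≤ ρ)
    (hdet : ∀ t ∈ Icc (0 : ℝ) 1, (symbolMatrix φ a ρ t).det ≠ 0) (N : ℕ) :
    ∃ C : ℝ, 0 ≤ C ∧ ∀ (i : Fin ρ) (x : ℝ),
      ‖reconstruction φ a ρ i x‖ ≤ C * ((1 + |x|) ^ N)⁻¹ := by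
  obtain ⟨R, hR0, hR⟩ := exists_eq_zero_of_lt_abs hφ
  obtain ⟨B, hB⟩ := hφ.exists_bound_of_continuous hφc
  have hB0 : 0 ≤ B := (norm_nonneg _).trans (hB 0)
  -- Of the $N+2$ powers, $N$ become decay in $x$, because $\varphi(x-\rho v-j)\ne0$ forces
  -- $1+|x|\le Q(1+|v|)$; the other two make the sum over $v$ converge.
  choose c hc using exists_inverseSymbolCoeff_mul_pow_le hφ a hρ hdet (N + 2)
  have hc0 : ∀ j i, 0 ≤ c j i := fun j i => le_trans (by positivity) (hc j i 0)
  set K : ℝ := ∑ i, ∑ j, c j i with hK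
  have hK0 : 0 ≤ K := Finset.sum_nonneg fun i _ => Finset.sum_nonneg fun j _ => hc0 j i
  set Q : ℝ := 1 + 2 * ρ + R with hQ
  have hQ0 : 0 ≤ Q := by positivity
  set Z : ℝ := ∑' v : ℤ, ((1 + |(v : ℝ)|) ^ 2)⁻¹ with hZ
  have hZ0 : 0 ≤ Z := tsum_nonneg fun v => by positivity
  refine ⟨K * B * Q ^ N * Z, by positivity, fun i x => ?_⟩
  have hsum : HasSum (fun v : ℤ => K * B * Q ^ N * ((1 + |x|) ^ N)⁻¹ * ((1 + |(v : ℝ)|) ^ 2)⁻¹)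
      (K * B * Q ^ N * ((1 + |x|) ^ N)⁻¹ * Z) := summable_int_one_add_abs_sq_inv.hasSum.mul_left _
  refine (tsum_of_norm_bounded hsum fun v => ?_).trans (le_of_eq (by ring))
  have hterm : ∀ j : Fin ρ, ‖inverseSymbolCoeff φ a ρ j i v * φ (x - (ρ : ℝ) * (v : ℝ) - (j : ℕ))‖ ≤
      c j i * (B * Q ^ N * ((1 + |x|) ^ N)⁻¹ * ((1 + |(v : ℝ)|) ^ 2)⁻¹) := by
    intro j
    have hv := abs_nonneg (v : ℝ)
    have hx := abs_nonneg x
    rcases lt_or_ge R |x - (ρ : ℝ) * (v : ℝ) - (j : ℕ)| with h | h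
    · rw [hR _ h, mul_zero, norm_zero]
      have := hc0 j i
      positivity
    · have h1 : |x| ≤ R + ρ * |(v : ℝ)| + ρ := by
        have hj : ((j : ℕ) : ℝ) ≤ ρ := by exact_mod_cast j.2.le
        calc |x| = |(x - (ρ : ℝ) * (v : ℝ) - (j : ℕ)) + (ρ : ℝ) * (v : ℝ) + (j : ℕ)| := by ring_nf
          _ ≤ |x - (ρ : ℝ) * (v : ℝ) - (j : ℕ)| + |(ρ : ℝ) * (v : ℝ)| + |((j : ℕ) : ℝ)| :=
            (abs_add_le _ _).trans (add_le_add_left (abs_add_le _ _) _)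
          _ ≤ _ := by
            rw [abs_mul, Nat.abs_cast, Nat.abs_cast]
            gcongr
      have h2 : (1 + |x|) ^ N ≤ (Q * (1 + |(v : ℝ)|)) ^ N := by
        gcongr
        have hρ0 : (0 : ℝ) ≤ ρ := by positivity
        rw [hQ]
        nlinarith [mul_nonneg hR0 hv, mul_nonneg hρ0 hv]
      have h3 : 1 ≤ Q ^ N * (1 + |(v : ℝ)|) ^ N * ((1 + |x|) ^ N)⁻¹ := by
        rw [← div_eq_mul_inv, one_le_div (by positivity), ← mul_pow]
        exact h2
      have h4 : ‖inverseSymbolCoeff φ a ρ j i v‖ ≤ c j i * ((1 + |(v : ℝ)|) ^ (N + 2))⁻¹ := by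
        rw [← div_eq_mul_inv, le_div_iff₀ (by positivity)]
        exact hc j i v
      have hcj := hc0 j i
      rw [norm_mul]
      calc _ ≤ (c j i * ((1 + |(v : ℝ)|) ^ (N + 2))⁻¹) * B := by
            gcongr
            exact hB _
        _ ≤ (c j i * ((1 + |(v : ℝ)|) ^ (N + 2))⁻¹) * B *
            (Q ^ N * (1 + |(v : ℝ)|) ^ N * ((1 + |x|) ^ N)⁻¹) :=
          le_mul_of_one_le_right (by positivity) h3
        _ = _ := by
          rw [pow_add]
          field_simp
  refine (norm_sum_le_of_le _ fun j _ => hterm j).trans ?_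
  rw [← Finset.sum_mul]
  have h5 : ∑ j, c j i ≤ K := Finset.single_le_sum (f := fun i => ∑ j, c j i)
    (fun i _ => Finset.sum_nonneg fun j _ => hc0 j i) (Finset.mem_univ i)
  calc _ ≤ K * (B * Q ^ N * ((1 + |x|) ^ N)⁻¹ * ((1 + |(v : ℝ)|) ^ 2)⁻¹) := by gcongr
    _ = _ := by ring

/-! ### The sampling series at unit bandwidth -/

/-- Comparing $t-\rho l$ with the integer $\lfloor t/\rho\rfloor-l$ makes the sum of the majorant
independent of $t$. -/
theorem hasSum_translate_bound {ρ : ℕ} (hρ : 1 ≤ ρ) (t : ℝ) :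
    ∃ b : ℤ → ℝ, (∀ l : ℤ, ((1 + |t - ρ * (l : ℝ)|) ^ 2)⁻¹ ≤ b l) ∧
      HasSum b (4 * ∑' v : ℤ, ((1 + |(v : ℝ)|) ^ 2)⁻¹) := by
  have hρ1 : (1 : ℝ) ≤ ρ := by exact_mod_cast hρ
  set n : ℤ := ⌊t / ρ⌋ with hn
  refine ⟨fun l => 4 * ((1 + |((n - l : ℤ) : ℝ)|) ^ 2)⁻¹, fun l => ?_, ?_⟩
  · have h1 : |t / ρ - l| ≤ |t - ρ * l| := by
      have : t - ρ * l = ρ * (t / ρ - l) := by field_simp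
      rw [this, abs_mul, Nat.abs_cast]
      exact le_mul_of_one_le_left (abs_nonneg _) hρ1
    have h2 : |((n - l : ℤ) : ℝ)| ≤ 1 + |t / ρ - l| := by
      have h3 : |(n : ℝ) - t / ρ| ≤ 1 := by
        rw [abs_le]
        exact ⟨by linarith [Int.lt_floor_add_one (t / ρ)], by linarith [Int.floor_le (t / ρ)]⟩
      push_cast
      calc |(n : ℝ) - l| = |(n - t / ρ) + (t / ρ - l)| := by ring_nf
        _ ≤ _ := (abs_add_le _ _).trans (by linarith)
    have h4 : (1 + |((n - l : ℤ) : ℝ)|) ^ 2 ≤ 4 * (1 + |t - ρ * l|) ^ 2 := by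
      calc _ ≤ (2 * (1 + |t - ρ * l|)) ^ 2 := by
            gcongr
            linarith [abs_nonneg (t - ρ * (l : ℝ))]
        _ = _ := by ring
    dsimp only
    rw [← div_eq_mul_inv, inv_eq_one_div, div_le_div_iff₀ (by positivity) (by positivity)]
    linarith
  · exact ((Equiv.subLeft n).hasSum_iff.2 summable_int_one_add_abs_sq_inv.hasSum).mul_left 4

theorem exists_reconstruction_series_le {φ : ℝ → ℂ} (hφ : HasCompactSupport φ)
    (hφc : Continuous φ) (a : ℝ) {ρ : ℕ} (hρ : 1 ≤ ρ)
    (hdet : ∀ t ∈ Icc (0 : ℝ) 1, (symbolMatrix φ a ρ t).det ≠ 0) (M : ℕ) :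
    ∃ C : ℝ, 0 ≤ C ∧ ∀ (t D : ℝ) (u : Fin ρ → ℤ → ℂ), 0 ≤ D →
      (∀ i l, ‖u i l‖ ≤ D * (1 + |a + ρ * (l : ℝ) - t|) ^ M) →
      Summable (fun l : ℤ => ∑ i, u i l * reconstruction φ a ρ i (t - ρ * (l : ℝ))) ∧
        ‖∑' l : ℤ, ∑ i, u i l * reconstruction φ a ρ i (t - ρ * (l : ℝ))‖ ≤ C * D := by
  obtain ⟨K, hK0, hK⟩ := exists_reconstruction_mul_pow_le hφ hφc a hρ hdet (M + 2)
  set Z : ℝ := ∑' v : ℤ, ((1 + |(v : ℝ)|) ^ 2)⁻¹ with hZ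
  have hZ0 : 0 ≤ Z := tsum_nonneg fun v => by positivity
  refine ⟨ρ * ((1 + |a|) ^ M * K) * (4 * Z), by positivity, fun t D u hD hu => ?_⟩
  obtain ⟨b, hb, hbs⟩ := hasSum_translate_bound hρ t
  have hterm : ∀ l : ℤ, ‖∑ i, u i l * reconstruction φ a ρ i (t - ρ * (l : ℝ))‖ ≤
      ρ * ((1 + |a|) ^ M * K) * D * b l := by
    intro l
    have h1 : ∀ i ∈ (Finset.univ : Finset (Fin ρ)),
        ‖u i l * reconstruction φ a ρ i (t - ρ * (l : ℝ))‖ ≤ (1 + |a|) ^ M * K * D * b l := by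
      intro i _
      set x := |t - ρ * (l : ℝ)| with hx
      have hx0 : 0 ≤ x := abs_nonneg _
      have h2 : 1 + |a + ρ * (l : ℝ) - t| ≤ (1 + |a|) * (1 + x) := by
        have h3 : |a + ρ * (l : ℝ) - t| ≤ |a| + x := by
          rw [hx, add_sub_assoc, abs_sub_comm t]
          exact abs_add_le _ _
        nlinarith [abs_nonneg a]
      have h4 : ‖u i l‖ ≤ D * ((1 + |a|) * (1 + x)) ^ M := (hu i l).trans (by gcongr)
      rw [norm_mul]
      calc _ ≤ D * ((1 + |a|) * (1 + x)) ^ M * (K * ((1 + x) ^ (M + 2))⁻¹) :=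
            mul_le_mul h4 (hK i _) (norm_nonneg _) (by positivity)
        _ = (1 + |a|) ^ M * K * D * ((1 + x) ^ 2)⁻¹ := by
            rw [mul_pow, pow_add]
            field_simp
        _ ≤ _ := by
            gcongr
            exact hb l
    refine (norm_sum_le_of_le _ h1).trans (le_of_eq ?_)
    rw [Finset.sum_const, Finset.card_univ, Fintype.card_fin, nsmul_eq_mul]
    ring
  have hs := hbs.mul_left (ρ * ((1 + |a|) ^ M * K) * D)
  refine ⟨Summable.of_norm_bounded hs.summable hterm,
    (tsum_of_norm_bounded hs hterm).trans (le_of_eq (by ring))⟩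

theorem samplingTerm_one (φ : ℝ → ℂ) (a : ℝ) (ρ : ℕ) (f : ℝ → ℂ) (t : ℝ) :
    samplingTerm φ a ρ 1 f t = fun l : ℤ => ∑ i : Fin ρ,
      iteratedDeriv (i : ℕ) f (a + ρ * (l : ℝ)) * reconstruction φ a ρ i (t - ρ * (l : ℝ)) := by
  ext l
  simp [samplingTerm]

theorem summable_samplingTerm_one {φ : ℝ → ℂ} (hφ : HasCompactSupport φ)
    (hφc : Continuous φ) (a : ℝ) {ρ : ℕ} (hρ : 1 ≤ ρ)
    (hdet : ∀ t ∈ Icc (0 : ℝ) 1, (symbolMatrix φ a ρ t).det ≠ 0) {g : ℝ → ℂ} {B : ℝ}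
    (hB : ∀ (i : Fin ρ) (l : ℤ), ‖iteratedDeriv (i : ℕ) g (a + ρ * (l : ℝ))‖ ≤ B) (t : ℝ) :
    Summable (samplingTerm φ a ρ 1 g t) := by
  obtain ⟨C, -, hC⟩ := exists_reconstruction_series_le hφ hφc a hρ hdet 0
  rw [samplingTerm_one]
  exact (hC t B _ ((norm_nonneg _).trans (hB ⟨0, hρ⟩ 0)) fun i l => by simpa using hB i l).1

theorem exists_norm_samplingOperator_one_sub_le {φ : ℝ → ℂ} (hφ : HasCompactSupport φ)
    (hφc : Continuous φ) (a : ℝ) {ρ r : ℕ} (hρ : 1 ≤ ρ) (hr : 1 ≤ r)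
    (hdet : ∀ t ∈ Icc (0 : ℝ) 1, (symbolMatrix φ a ρ t).det ≠ 0)
    (hrep : ReproducesPolynomials φ a ρ r) :
    ∃ C : ℝ, 0 ≤ C ∧ ∀ g : ℝ → ℂ, LocallyIntervalIntegrable g →
      (∀ i : ℕ, i + 1 < ρ → Differentiable ℝ (iteratedDeriv i g)) → ∀ B : ℝ,
      (∀ (i : Fin ρ) (l : ℤ), ‖iteratedDeriv (i : ℕ) g (a + ρ * (l : ℝ))‖ ≤ B) →
      ∀ t A : ℝ, 0 ≤ A →
      (∀ i < ρ, ∀ y, ∀ h ∈ Icc (0 : ℝ) (1 / 4),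
        ‖(fwdDiff h)^[r] (iteratedDeriv i g) y‖ ≤ A * (1 + |y - t|) ^ 2) →
      ‖samplingOperator φ a ρ 1 g t - g t‖ ≤ C * A := by
  obtain ⟨C, hC0, hC⟩ := exists_polynomial_of_fwdDiff_iteratedDeriv_le hr ρ
  obtain ⟨K, hK0, hK⟩ := exists_reconstruction_series_le hφ hφc a hρ hdet (r + 2)
  refine ⟨K * C + C, by positivity, fun g hg hd B hB t A hA hΔ => ?_⟩
  obtain ⟨P, hP, hgP⟩ := hC g hg hd t A hA hΔ
  have hB0 : 0 ≤ B := (norm_nonneg _).trans (hB ⟨0, hρ⟩ 0)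
  set p : ℝ → ℂ := fun x => P.eval (x : ℂ) with hp
  have hone : ∀ l : ℤ, 1 ≤ (1 + |a + ρ * (l : ℝ) - t|) ^ (r + 2) := fun l =>
    one_le_pow₀ (by linarith [abs_nonneg (a + ρ * (l : ℝ) - t)])
  -- Splitting the series of $g-P$ requires summability for $P$ too. The bound $B$ serves only this
  -- and does not enter the final constant.
  have hsp := (hK t (B + C * A) (fun i l => iteratedDeriv (i : ℕ) p (a + ρ * (l : ℝ)))
    (by positivity) fun i l => by
      have h1 := norm_sub_norm_le (iteratedDeriv (i : ℕ) p (a + ρ * (l : ℝ)))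
        (iteratedDeriv (i : ℕ) g (a + ρ * (l : ℝ)))
      rw [norm_sub_rev] at h1
      have h2 := hgP i i.2 (a + ρ * (l : ℝ))
      have h3 := hB i l
      nlinarith [hone l]).1
  have hsg := summable_samplingTerm_one hφ hφc a hρ hdet hB t
  rw [samplingTerm_one] at hsg
  have hdiff := (hK t (C * A) (fun i l => iteratedDeriv (i : ℕ) g (a + ρ * (l : ℝ)) -
    iteratedDeriv (i : ℕ) p (a + ρ * (l : ℝ))) (by positivity) fun i l => hgP i i.2 _).2
  have hEq : samplingOperator φ a ρ 1 g t - p t = ∑' l : ℤ, ∑ i : Fin ρ,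
      (iteratedDeriv (i : ℕ) g (a + ρ * (l : ℝ)) - iteratedDeriv (i : ℕ) p (a + ρ * (l : ℝ))) *
        reconstruction φ a ρ i (t - ρ * (l : ℝ)) := by
    have hpt : samplingOperator φ a ρ 1 p t = p t := hrep 1 le_rfl P (by omega) t
    rw [← hpt, samplingOperator, samplingOperator,
      samplingTerm_one, samplingTerm_one, ← hsg.tsum_sub hsp]
    simp only [sub_mul, Finset.sum_sub_distrib]
  have h0 : ‖g t - p t‖ ≤ C * A := by simpa using hgP 0 hρ t
  calc ‖samplingOperator φ a ρ 1 g t - g t‖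
      = ‖(samplingOperator φ a ρ 1 g t - p t) - (g t - p t)‖ := by ring_nf
    _ ≤ K * (C * A) + C * A := by
      refine (norm_sub_le _ _).trans (add_le_add ?_ h0)
      rw [hEq]
      exact hdiff
    _ = _ := by ring

/-! ### Norm estimates -/

/-- Hölder's inequality with weights. Integrating it yields Minkowski's inequality for sums of
translates, with a constant free of $p$. -/
theorem tsum_mul_rpow_le {ι : Type*} {p : ℝ} (hp : 1 ≤ p) (w f : ι → ℝ≥0∞) :
    (∑' i, w i * f i) ^ p ≤ (∑' i, w i) ^ (p - 1) * ∑' i, w i * f i ^ p := by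
  have hp0 : 0 < p := by linarith
  have h1 : ∑' i, w i * f i ≤ (∑' i, w i) ^ (1 - p⁻¹) * (∑' i, w i * f i ^ p) ^ p⁻¹ := by
    rw [ENNReal.tsum_eq_iSup_sum]
    refine iSup_le fun s => (ENNReal.inner_le_weight_mul_Lp_of_nonneg s hp w f).trans ?_
    have h2 : 0 ≤ 1 - p⁻¹ := sub_nonneg.2 (inv_le_one_of_one_le₀ hp)
    exact mul_le_mul' (ENNReal.rpow_le_rpow (ENNReal.sum_le_tsum s) h2)
      (ENNReal.rpow_le_rpow (ENNReal.sum_le_tsum s) (inv_nonneg.2 hp0.le))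
  refine (ENNReal.rpow_le_rpow h1 hp0.le).trans (le_of_eq ?_)
  rw [ENNReal.mul_rpow_of_nonneg _ _ hp0.le, ← ENNReal.rpow_mul, ← ENNReal.rpow_mul,
    inv_mul_cancel₀ hp0.ne', ENNReal.rpow_one, sub_mul, one_mul, inv_mul_cancel₀ hp0.ne']

theorem eLpNorm_tsum_translate_le {p : ℝ} (hp : 1 ≤ p) (w : ℤ → ℝ≥0∞) (s : ℤ → ℝ)
    {F : ℝ → ℝ≥0∞} (hF : Measurable F) :
    eLpNorm (fun t => ∑' j, w j * F (t - s j)) (ENNReal.ofReal p) volume ≤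
      (∑' j, w j) * eLpNorm F (ENNReal.ofReal p) volume := by
  have hp0 : 0 < p := by linarith
  have hp1 : ENNReal.ofReal p ≠ 0 := by simpa using hp0
  rw [eLpNorm_eq_lintegral_rpow_enorm_toReal hp1 ENNReal.ofReal_ne_top,
    eLpNorm_eq_lintegral_rpow_enorm_toReal hp1 ENNReal.ofReal_ne_top,
    ENNReal.toReal_ofReal hp0.le]
  simp only [enorm_eq_self]
  have h1 : ∫⁻ t, (∑' j, w j * F (t - s j)) ^ p ≤ (∑' j, w j) ^ p * ∫⁻ t, F t ^ p := by
    have hmeas : ∀ j, Measurable fun t => w j * F (t - s j) ^ p := fun j => by fun_prop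
    calc ∫⁻ t, (∑' j, w j * F (t - s j)) ^ p
        ≤ ∫⁻ t, (∑' j, w j) ^ (p - 1) * ∑' j, w j * F (t - s j) ^ p :=
          lintegral_mono fun t => tsum_mul_rpow_le hp w _
      _ = (∑' j, w j) ^ (p - 1) * ∑' j, w j * ∫⁻ t, F t ^ p := by
          rw [lintegral_const_mul _ (Measurable.tsum hmeas),
            lintegral_tsum fun j => (hmeas j).aemeasurable]
          congr 1
          refine tsum_congr fun j => ?_
          rw [lintegral_const_mul _ (by fun_prop),
            lintegral_sub_right_eq_self (fun t => F t ^ p) (s j)]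
      _ = _ := by
          rw [ENNReal.tsum_mul_right, ← mul_assoc]
          congr 1
          nth_rw 2 [← ENNReal.rpow_one (∑' j, w j)]
          rw [← ENNReal.rpow_add_of_nonneg _ _ (by linarith) zero_le_one, sub_add_cancel]
  refine (ENNReal.rpow_le_rpow h1 (by positivity)).trans (le_of_eq ?_)
  rw [ENNReal.mul_rpow_of_nonneg _ _ (by positivity), ← ENNReal.rpow_mul,
    mul_one_div_cancel hp0.ne', ENNReal.rpow_one]

/-- The supremum of the differences with steps in `[0, 1/4]` at the points of the cell
`[k/4, (k+1)/4)`. -/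
noncomputable def cellModulus (r : ℕ) (g : ℝ → ℂ) (k : ℤ) : ℝ≥0∞ :=
  ⨆ (t : ℝ) (h : ℝ) (_ : ⌊4 * t⌋ = k) (_ : h ∈ Icc (0 : ℝ) (1 / 4)), ‖(fwdDiff h)^[r] g t‖ₑ

theorem enorm_fwdDiff_le_cellModulus (r : ℕ) (g : ℝ → ℂ) (t : ℝ) {h : ℝ}
    (hh : h ∈ Icc (0 : ℝ) (1 / 4)) : ‖(fwdDiff h)^[r] g t‖ₑ ≤ cellModulus r g ⌊4 * t⌋ :=
  le_iSup_of_le t <| le_iSup_of_le h <| le_iSup_of_le rfl <| le_iSup_of_le hh le_rfl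

/-- Points of one cell are less than $1/4$ apart, and $1/4+r/4\le r/2$, so the difference fits in
the window. -/
theorem cellModulus_le_localModulus {r : ℕ} (hr : 1 ≤ r) (g : ℝ → ℂ) (x : ℝ) :
    cellModulus r g ⌊4 * x⌋ ≤ localModulus r g x 1 := by
  refine iSup_le fun t => iSup_le fun h => iSup_le fun ht => iSup_le fun hh => ?_
  have hr1 : (1 : ℝ) ≤ r := by exact_mod_cast hr
  have h1 := Int.abs_sub_lt_one_of_floor_eq_floor ht
  rw [abs_lt] at h1
  refine le_iSup_of_le t <| le_iSup_of_le h <| le_iSup_of_le ?_ <| le_iSup_of_le ?_ le_rfl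
  · exact ⟨by linarith, by linarith⟩
  · exact ⟨by nlinarith [hh.1], by nlinarith [hh.2]⟩

/-- The convolution estimate needs measurability, which is immediate here and unclear for the local
modulus. The latter enters only through monotonicity of the norm. -/
theorem measurable_cellModulus_floor (r : ℕ) (g : ℝ → ℂ) :
    Measurable fun t : ℝ => cellModulus r g ⌊4 * t⌋ :=
  (measurable_from_top (f := cellModulus r g)).comp
    (Int.measurable_floor.comp (measurable_const.mul measurable_id))

/-- The weights of the convolution that dominates the approximation error. -/
noncomputable def decayWeight (j : ℤ) : ℝ≥0∞ := ENNReal.ofReal ((1 + |(j : ℝ)|) ^ 2)⁻¹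

theorem tsum_decayWeight_ne_top : ∑' j, decayWeight j ≠ ∞ :=
  summable_int_one_add_abs_sq_inv.tsum_ofReal_ne_top

theorem norm_fwdDiff_le_of_tsum_ne_top {r : ℕ} {g : ℝ → ℂ} {μ : ℤ → ℝ≥0∞}
    (hμ : ∀ k, cellModulus r g k ≤ μ k) {t : ℝ}
    (hfin : ∑' j : ℤ, decayWeight j * μ ⌊4 * (t - j / 4)⌋ ≠ ∞) (y : ℝ) {h : ℝ}
    (hh : h ∈ Icc (0 : ℝ) (1 / 4)) :
    ‖(fwdDiff h)^[r] g y‖ ≤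
      16 * (∑' j : ℤ, decayWeight j * μ ⌊4 * (t - j / 4)⌋).toReal * (1 + |y - t|) ^ 2 := by
  set T := ∑' j : ℤ, decayWeight j * μ ⌊4 * (t - j / 4)⌋ with hT
  -- With this $j$ the point $t-j/4$ lies in the cell of $y$, so a single summand of $T$ suffices.
  -- Its weight costs $(1+|j|)^2\le16(1+|y-t|)^2$.
  set j : ℤ := ⌊4 * t⌋ - ⌊4 * y⌋ with hj
  have h1 : ⌊4 * (t - (j : ℝ) / 4)⌋ = ⌊4 * y⌋ := by
    have : 4 * (t - (j : ℝ) / 4) = 4 * t - j := by ring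
    rw [this, Int.floor_sub_intCast]
    omega
  have h2 : decayWeight j * ‖(fwdDiff h)^[r] g y‖ₑ ≤ T := by
    refine le_trans ?_ (ENNReal.le_tsum (f := fun j : ℤ => decayWeight j * μ ⌊4 * (t - j / 4)⌋) j)
    rw [h1]
    gcongr
    exact (enorm_fwdDiff_le_cellModulus r g y hh).trans (hμ _)
  have h3 := ENNReal.toReal_mono hfin h2
  rw [ENNReal.toReal_mul, decayWeight, ENNReal.toReal_ofReal (by positivity), toReal_enorm,
    inv_mul_le_iff₀ (by positivity)] at h3
  have h4 : 1 + |(j : ℝ)| ≤ 4 * (1 + |y - t|) := by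
    have h5 : |(j : ℝ)| ≤ 4 * |y - t| + 1 := by
      rw [hj]
      push_cast
      have ha := Int.floor_le (4 * t)
      have hb := Int.lt_floor_add_one (4 * t)
      have hc := Int.floor_le (4 * y)
      have hd := Int.lt_floor_add_one (4 * y)
      have he := neg_abs_le (y - t)
      have hf := le_abs_self (y - t)
      rw [abs_le]
      exact ⟨by linarith, by linarith⟩
    linarith [abs_nonneg (y - t)]
  have hT0 : 0 ≤ T.toReal := ENNReal.toReal_nonneg
  calc _ ≤ (1 + |(j : ℝ)|) ^ 2 * T.toReal := h3
    _ ≤ (4 * (1 + |y - t|)) ^ 2 * T.toReal := by gcongr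
    _ = _ := by ring

theorem exists_eLpNorm_samplingOperator_one_sub_le {φ : ℝ → ℂ} (hφ : HasCompactSupport φ)
    (hφc : Continuous φ) (a : ℝ) {ρ r : ℕ} (hρ : 1 ≤ ρ) (hr : 1 ≤ r)
    (hdet : ∀ t ∈ Icc (0 : ℝ) 1, (symbolMatrix φ a ρ t).det ≠ 0)
    (hrep : ReproducesPolynomials φ a ρ r) :
    ∃ C : ℝ≥0, ∀ p : ℝ, 1 ≤ p → ∀ g : ℝ → ℂ, LocallyIntervalIntegrable g →
      (∀ i : ℕ, i + 1 < ρ → Differentiable ℝ (iteratedDeriv i g)) → ∀ B : ℝ,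
      (∀ (i : Fin ρ) (l : ℤ), ‖iteratedDeriv (i : ℕ) g (a + ρ * (l : ℝ))‖ ≤ B) →
      eLpNorm (fun t => samplingOperator φ a ρ 1 g t - g t) (ENNReal.ofReal p) volume ≤
        ∑ i ∈ Finset.range ρ, (C : ℝ≥0∞) * averagedModulus r (iteratedDeriv i g) 1 p := by
  obtain ⟨C, hC0, hC⟩ := exists_norm_samplingOperator_one_sub_le hφ hφc a hρ hr hdet hrep
  -- The summand $1$ keeps $K$ nonzero, so the bound is trivial where the dominating sum is
  -- infinite.
  set K : ℝ≥0 := (16 * C + 1).toNNReal with hK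
  set Z : ℝ≥0 := (∑' j, decayWeight j).toNNReal with hZ
  have hZ' : (Z : ℝ≥0∞) = ∑' j, decayWeight j := ENNReal.coe_toNNReal tsum_decayWeight_ne_top
  refine ⟨K * Z, fun p hp g hg hd B hB => ?_⟩
  set μ : ℤ → ℝ≥0∞ := fun k => ∑ i ∈ Finset.range ρ, cellModulus r (iteratedDeriv i g) k with hμ
  set F : ℝ → ℝ≥0∞ := ∑ i ∈ Finset.range ρ,
    fun t => cellModulus r (iteratedDeriv i g) ⌊4 * t⌋ with hF
  have hFμ : ∀ t, F t = μ ⌊4 * t⌋ := fun t => by simp [hF, hμ]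
  have hFm : Measurable F := by
    rw [funext hFμ]
    exact Finset.measurable_sum _ fun i _ => measurable_cellModulus_floor r (iteratedDeriv i g)
  have hK0 : (K : ℝ≥0∞) ≠ 0 := by
    simp only [hK, ne_eq, ENNReal.coe_eq_zero, Real.toNNReal_eq_zero, not_le]
    positivity
  have hpt : ∀ t, ‖samplingOperator φ a ρ 1 g t - g t‖ₑ ≤
      K * ∑' j : ℤ, decayWeight j * F (t - j / 4) := by
    intro t
    simp only [hFμ]
    set T := ∑' j : ℤ, decayWeight j * μ ⌊4 * (t - j / 4)⌋ with hT
    by_cases hfin : T = ∞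
    · rw [hfin, ENNReal.mul_top hK0]
      exact le_top
    have h1 := hC g hg hd B hB t (16 * T.toReal) (by positivity) fun i hi y h hh =>
      norm_fwdDiff_le_of_tsum_ne_top (fun k => Finset.single_le_sum
        (f := fun i => cellModulus r (iteratedDeriv i g) k) (fun _ _ => zero_le)
        (Finset.mem_range.2 hi)) hfin y hh
    rw [← ofReal_norm]
    calc ENNReal.ofReal _ ≤ ENNReal.ofReal ((16 * C + 1) * T.toReal) := by
          refine ENNReal.ofReal_le_ofReal (h1.trans ?_)
          have : 0 ≤ T.toReal := ENNReal.toReal_nonneg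
          nlinarith
      _ = K * T := by
          rw [ENNReal.ofReal_mul (by positivity), ENNReal.ofReal_toReal hfin, hK]
          rfl
  calc _ ≤ eLpNorm (fun t => (K : ℝ≥0∞) * ∑' j : ℤ, decayWeight j * F (t - j / 4))
          (ENNReal.ofReal p) volume := eLpNorm_mono_enorm fun t => by simpa using hpt t
    _ ≤ eLpNorm (fun t => ∑' j : ℤ, (K * decayWeight j) * F (t - j / 4))
          (ENNReal.ofReal p) volume := by
        simp only [mul_assoc, ENNReal.tsum_mul_left]
        exact le_rfl
    _ ≤ (∑' j, K * decayWeight j) * eLpNorm F (ENNReal.ofReal p) volume :=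
        eLpNorm_tsum_translate_le hp _ _ hFm
    _ ≤ (K * Z) * ∑ i ∈ Finset.range ρ, averagedModulus r (iteratedDeriv i g) 1 p := by
        rw [ENNReal.tsum_mul_left, hZ']
        gcongr
        refine (eLpNorm_sum_le (fun i _ =>
          (measurable_cellModulus_floor r _).aestronglyMeasurable)
          (by simpa using hp)).trans (Finset.sum_le_sum fun i _ => ?_)
        exact eLpNorm_mono_enorm fun t => by
          simpa using cellModulus_le_localModulus hr (iteratedDeriv i g) t
    _ = _ := by
        rw [Finset.mul_sum]
        push_cast
        rfl

/-! ### Change of bandwidth -/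

theorem iteratedDeriv_dilate (f : ℝ → ℂ) (c : ℝ) (i : ℕ) :
    iteratedDeriv i (fun x => f (c * x)) = fun x => (c : ℂ) ^ i * iteratedDeriv i f (c * x) := by
  induction i with
  | zero => simp
  | succ i ih =>
    ext x
    rw [iteratedDeriv_succ, ih, deriv_const_mul_field, deriv_comp_mul_left, iteratedDeriv_succ,
      Complex.real_smul, pow_succ, mul_assoc]

theorem samplingTerm_eq_dilate (φ : ℝ → ℂ) (a : ℝ) (ρ : ℕ) (W : ℝ) (f : ℝ → ℂ) (t : ℝ) :
    samplingTerm φ a ρ W f t = samplingTerm φ a ρ 1 (fun x => f (W⁻¹ * x)) (W * t) := by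
  ext l
  rw [samplingTerm_one]
  simp only [samplingTerm, iteratedDeriv_dilate]
  refine Finset.sum_congr rfl fun i _ => ?_
  rw [div_eq_inv_mul (a + _) W]
  push_cast
  rw [inv_pow, one_div]

theorem localModulus_dilate_le (r : ℕ) (f : ℝ → ℂ) {W : ℝ} (hW : 1 ≤ W) (i : ℕ) (x : ℝ) :
    localModulus r (iteratedDeriv i fun x => f (W⁻¹ * x)) x 1 ≤
      localModulus r (iteratedDeriv i f) (W⁻¹ * x) W⁻¹ := by
  have hW0 : 0 < W⁻¹ := by positivity
  refine iSup_le fun t => iSup_le fun h => iSup_le fun ht => iSup_le fun hh => ?_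
  refine le_trans ?_ (le_iSup_of_le (W⁻¹ * t) <| le_iSup_of_le (W⁻¹ * h) <| le_iSup_of_le ?_ <|
    le_iSup_of_le ?_ le_rfl)
  · have h1 : (fwdDiff h)^[r] (iteratedDeriv i fun x => f (W⁻¹ * x)) t =
        ((W⁻¹ : ℝ) : ℂ) ^ i * (fwdDiff (W⁻¹ * h))^[r] (iteratedDeriv i f) (W⁻¹ * t) := by
      simp only [fwdDiff_iter_eq_alternating_sum, iteratedDeriv_dilate, Finset.mul_sum]
      refine Finset.sum_congr rfl fun j _ => ?_
      rw [mul_add, mul_left_comm W⁻¹]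
      ring
    rw [h1, enorm_mul, enorm_pow]
    refine mul_le_of_le_one_left zero_le (pow_le_one₀ zero_le ?_)
    rw [← ofReal_norm, Complex.norm_real, Real.norm_of_nonneg hW0.le]
    simpa using inv_le_one_of_one_le₀ hW
  · exact ⟨by nlinarith [ht.1], by nlinarith [ht.2]⟩
  · exact ⟨by nlinarith [hh.1], by nlinarith [hh.2]⟩

theorem exists_eLpNorm_comp_mul_left_eq {W : ℝ} (hW : 0 < W) {p : ℝ} (hp : 1 ≤ p) :
    ∃ k : ℝ≥0∞, (∀ F : ℝ → ℂ, eLpNorm (fun t => F (W * t)) (ENNReal.ofReal p) volume =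
        k * eLpNorm F (ENNReal.ofReal p) volume) ∧
      ∀ F : ℝ → ℝ≥0∞, eLpNorm (fun t => F (W * t)) (ENNReal.ofReal p) volume =
        k * eLpNorm F (ENNReal.ofReal p) volume := by
  have hp0 : 0 < p := by linarith
  have hp1 : ENNReal.ofReal p ≠ 0 := by simpa using hp0
  have hemb : MeasurableEmbedding fun t : ℝ => W * t :=
    (Homeomorph.mulLeft₀ W hW.ne').measurableEmbedding
  refine ⟨ENNReal.ofReal |W⁻¹| ^ (1 / p), fun F => ?_, fun F => ?_⟩
  all_goals
    have h1 := hemb.eLpNorm_map_measure (g := F) (p := ENNReal.ofReal p) (μ := volume)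
    rw [Real.map_volume_mul_left hW.ne', eLpNorm_smul_measure_of_ne_top ENNReal.ofReal_ne_top]
      at h1
    rw [← Function.comp_def F, ← h1, smul_eq_mul]
    simp [hp0.le]

theorem MemLambda.locallyIntervalIntegrable {ρ : ℕ} {p : ℝ} {f : ℝ → ℂ} (hf : MemLambda ρ p f) :
    LocallyIntervalIntegrable f := by
  obtain ⟨C, hC⟩ := hf.bounded
  intro x y
  rw [intervalIntegrable_iff]
  exact Measure.integrableOn_of_bounded (M := C) (by simp)
    hf.measurable.aestronglyMeasurable (Filter.Eventually.of_forall hC)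

/-- Along an arithmetic progression every single term of the finite discrete norm is bounded by the
whole sum. This makes the sampling series converge even if the derivatives are unbounded. -/
theorem MemLambda.exists_norm_iteratedDeriv_le {ρ : ℕ} {p : ℝ} {f : ℝ → ℂ} (hf : MemLambda ρ p f)
    (hp : 1 ≤ p) {x : ℤ → ℝ} {m : ℝ} (hm : 0 < m) (hx : ∀ j, x j - x (j - 1) = m) :
    ∃ B : ℝ, ∀ i < ρ, ∀ j, ‖iteratedDeriv i f (x j)‖ ≤ B := by
  have hp0 : 0 < p := by linarith
  have h1 := hf.discreteNorm_lt_top x ⟨⟨m, hm, fun j => (hx j).ge⟩, m, fun j => (hx j).le⟩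
  rw [discreteNorm, ENNReal.rpow_lt_top_iff_of_pos (by positivity)] at h1
  set T := ∑' j : ℤ, ∑ i ∈ Finset.range ρ,
    ‖iteratedDeriv i f (x j)‖ₑ ^ p * ENNReal.ofReal (x j - x (j - 1)) with hT
  have hm' : ENNReal.ofReal m ≠ 0 := by simpa using hm
  have hfin : (T / ENNReal.ofReal m) ^ p⁻¹ ≠ ∞ :=
    ENNReal.rpow_ne_top_of_nonneg (by positivity) (ENNReal.div_ne_top h1.ne hm')
  refine ⟨((T / ENNReal.ofReal m) ^ p⁻¹).toReal, fun i hi j => ?_⟩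
  have h2 : ‖iteratedDeriv i f (x j)‖ₑ ^ p * ENNReal.ofReal m ≤ T := by
    rw [← hx j]
    exact (Finset.single_le_sum (f := fun i => ‖iteratedDeriv i f (x j)‖ₑ ^ p *
      ENNReal.ofReal (x j - x (j - 1))) (fun _ _ => zero_le) (Finset.mem_range.2 hi)).trans
      (ENNReal.le_tsum (f := fun j => ∑ i ∈ Finset.range ρ, ‖iteratedDeriv i f (x j)‖ₑ ^ p *
        ENNReal.ofReal (x j - x (j - 1))) j)
  have h3 : ‖iteratedDeriv i f (x j)‖ₑ ≤ (T / ENNReal.ofReal m) ^ p⁻¹ := by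
    rw [ENNReal.le_rpow_inv_iff hp0, ENNReal.le_div_iff_mul_le (Or.inl hm') (Or.inl ENNReal.ofReal_ne_top)]
    exact h2
  rw [← toReal_enorm]
  exact ENNReal.toReal_mono hfin h3

end DerivativeSampling

theorem theorem4p4 (φ : ℝ → ℂ) (a : ℝ) (ρ r : ℕ) (hρ : 1 ≤ ρ) (hρr : ρ ≤ r)
    (ha : a ∈ Set.Ico (0 : ℝ) (ρ : ℝ))
    (hφ : ContDiff ℝ ((ρ - 1 : ℕ) : ℕ∞) φ) (hφ_supp : HasCompactSupport φ)
    (hdet : ∀ t ∈ Set.Icc (0 : ℝ) 1, (DerivativeSampling.symbolMatrix φ a ρ t).det ≠ 0)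
    (hrep : DerivativeSampling.ReproducesPolynomials φ a ρ r) :
    ∃ c : ℕ → ℝ≥0, ∀ p : ℝ, 1 ≤ p → ∀ f : ℝ → ℂ, DerivativeSampling.MemLambda ρ p f →
      ∀ W : ℝ, 1 ≤ W →
        (∀ t : ℝ, Summable (DerivativeSampling.samplingTerm φ a ρ W f t)) ∧
        eLpNorm (fun t => DerivativeSampling.samplingOperator φ a ρ W f t - f t)
            (ENNReal.ofReal p) volume ≤
          ∑ i ∈ Finset.range ρ,
            (c i : ℝ≥0∞) * DerivativeSampling.averagedModulus r (iteratedDeriv i f) W⁻¹ p := by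
  obtain ⟨C, hC⟩ := DerivativeSampling.exists_eLpNorm_samplingOperator_one_sub_le hφ_supp hφ.continuous a hρ
    (hρ.trans hρr) hdet hrep
  refine ⟨fun _ => C, fun p hp f hf W hW => ?_⟩
  have hW0 : 0 < W := by linarith
  set g : ℝ → ℂ := fun x => f (W⁻¹ * x) with hg
  have hρ0 : (0 : ℝ) < ρ := by exact_mod_cast hρ
  -- The sampling points of $S_W$ form a progression of spacing $\rho/W$.
  obtain ⟨B, hB⟩ := hf.exists_norm_iteratedDeriv_le hp (m := W⁻¹ * ρ)
    (x := fun l : ℤ => W⁻¹ * (a + ρ * (l : ℝ))) (by positivity) fun j => by push_cast; ring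
  have hgB : ∀ (i : Fin ρ) (l : ℤ), ‖iteratedDeriv (i : ℕ) g (a + ρ * (l : ℝ))‖ ≤ B := by
    intro i l
    simp only [hg, DerivativeSampling.iteratedDeriv_dilate]
    rw [norm_mul, norm_pow, Complex.norm_real, Real.norm_of_nonneg (by positivity)]
    exact (mul_le_of_le_one_left (norm_nonneg _)
      (pow_le_one₀ (by positivity) (inv_le_one_of_one_le₀ hW))).trans (hB i i.2 l)
  have hgd : ∀ i : ℕ, i + 1 < ρ → Differentiable ℝ (iteratedDeriv i g) := by
    intro i hi
    simp only [hg, DerivativeSampling.iteratedDeriv_dilate]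
    exact ((hf.differentiable i hi).comp (differentiable_id.const_mul W⁻¹)).const_mul _
  have hgi : DerivativeSampling.LocallyIntervalIntegrable g := fun x y => by
    simpa using hf.locallyIntervalIntegrable.comp_affine 0 W⁻¹ x y
  refine ⟨fun t => ?_, ?_⟩
  · rw [DerivativeSampling.samplingTerm_eq_dilate]
    exact DerivativeSampling.summable_samplingTerm_one hφ_supp hφ.continuous a hρ hdet hgB _
  obtain ⟨k, hk, hk'⟩ := DerivativeSampling.exists_eLpNorm_comp_mul_left_eq hW0 hp
  have hS : (fun t => DerivativeSampling.samplingOperator φ a ρ W f t - f t) =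
      fun t => (fun s => DerivativeSampling.samplingOperator φ a ρ 1 g s - g s) (W * t) := by
    ext t
    simp only [DerivativeSampling.samplingOperator, hg]
    rw [DerivativeSampling.samplingTerm_eq_dilate, inv_mul_cancel_left₀ hW0.ne']
  rw [hS, hk fun s => DerivativeSampling.samplingOperator φ a ρ 1 g s - g s]
  calc _ ≤ k * ∑ i ∈ Finset.range ρ,
        (C : ℝ≥0∞) * DerivativeSampling.averagedModulus r (iteratedDeriv i g) 1 p := by
        gcongr
        exact hC p hp g hgi hgd B hgB
    _ ≤ _ := by
        rw [Finset.mul_sum]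
        refine Finset.sum_le_sum fun i _ => ?_
        rw [mul_left_comm]
        gcongr
        have h1 := hk' fun x =>
          DerivativeSampling.localModulus r (iteratedDeriv i f) (W⁻¹ * x) W⁻¹
        simp only [inv_mul_cancel_left₀ hW0.ne'] at h1
        rw [DerivativeSampling.averagedModulus, DerivativeSampling.averagedModulus, h1]
        gcongr
        exact eLpNorm_mono_enorm fun x => by
          simpa using DerivativeSampling.localModulus_dilate_le r f hW i x
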